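/- Let $m\ge 1$, $L=\{1,\dots,m\}$. For a finite nonempty set $K\subseteq L$ and a function $h\colon\mathbb{R}^K\to\mathbb{C}$ put $$\Lambda_K(h)(\mathbf{s})=\sum_{\alpha}(-1)^{|\alpha|-1}(|\alpha|-1)!\prod_{J\in\alpha}h(\psi_{J,K}(\mathbf{s})),\qquad \mathbf{s}\in\mathbb{R}^K,$$ where $\alpha$ runs over all set partitions of $K$, $|\alpha|$ is the number of parts of $\alpha$, and $\psi_{J,K}\colon\mathbb{R}^K\to\mathbb{R}^K$ sets all coordinates with index in $K\setminus J$ to $0$. Let $\chi_{K,L}\colon\mathbb{R}^K\to\mathbb{R}^L$ be the injection that fills up the coordinates with index in $L\setminus K$ by $0$, and let $\|\cdot\|$ denote the maximum norm. There is a constant $C_m$, depending only on $m$, such that the following holds. Let $\mathbf{X}$ and $\mathbf{Y}$ be $m$-dimensional real random vectors with distribution functions $F_{\mathbf{X}}(\mathbf{z})=\mathbb{P}(\mathbf{X}\le\mathbf{z})$ (componentwise inequality) and $F_{\mathbf{Y}}$, and characteristic functions $\varphi_{\mathbf{X}}(\mathbf{t})=\mathbb{E}(e^{i\langle\mathbf{t},\mathbf{X}\rangle})$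 and $\varphi_{\mathbf{Y}}$. Assume that $F_{\mathbf{Y}}$ is differentiable, let $$A_j=\sup_{\mathbf{y}\in\mathbb{R}^m}\frac{\partial F_{\mathbf{Y}}(\mathbf{y})}{\partial y_j}\in[0,\infty],\qquad 1\le j\le m,$$ and let $T>0$. Then $$\sup_{\mathbf{z}\in\mathbb{R}^m}|F_{\mathbf{X}}(\mathbf{z})-F_{\mathbf{Y}}(\mathbf{z})|\le C_m\biggl(\sum_{\emptyset\ne K\subseteq L}\int_{\|\mathbf{t}_K\|\le T}\biggl|\frac{\Lambda_K(\varphi_{\mathbf{X}}\circ\chi_{K,L})(\mathbf{t}_K)-\Lambda_K(\varphi_{\mathbf{Y}}\circ\chi_{K,L})(\mathbf{t}_K)}{\prod_{k\in K}t_k}\biggr|\,d\mathbf{t}_K+\frac{\sum_{j=1}^mA_j}{T}\biggr),$$ where the integrals take values in $[0,\infty]$ and the inequality is trivially true if the right-hand side is infinite. If moreover $\mathbb{E}(\mathbf{X})$ and $\mathbb{E}(\mathbf{Y})$ exist (that is, all coordinates of $\mathbf{X}$ and $\mathbf{Y}$ are integrable), then all these integrals are finite. -/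

import Mathlib

open MeasureTheory
open scoped ENNReal NNReal Nat

noncomputable section

namespace BerryEsseen

/-- The cumulative distribution function `F_X(z) = P(X ≤ z)` of a random vector `X`,
where `≤` is the componentwise order. -/
def cdfVec {Ω ι : Type*} [MeasurableSpace Ω] (P : Measure Ω) (X : Ω → ι → ℝ) (z : ι → ℝ) : ℝ :=
  P.real {ω | X ω ≤ z}

/-- The characteristic function `φ_X(t) = E(exp(i⟨t, X⟩))` of a random vector `X`. The vectors are
regarded as elements of Euclidean space only in order to use the standard inner product. -/
def charFunVec {Ω ι : Type*} [MeasurableSpace Ω] [Fintype ι] (P : Measure Ω) (X : Ω → ι → ℝ)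
    (t : ι → ℝ) : ℂ :=
  charFun (P.map fun ω => WithLp.toLp 2 (X ω)) (WithLp.toLp 2 t)

/-- The injection `χ_{K,L}` of the vectors indexed by `K` into the vectors indexed by the whole
index set, filling up with zeros. -/
def chi {R ι : Type*} [Zero R] [DecidableEq ι] (K : Finset ι) (s : K → R) : ι → R :=
  fun l => if h : l ∈ K then s ⟨l, h⟩ else 0

/-- The projection `ψ_{J,K}` on the vectors indexed by `K`, which sets all coordinates outside
of `J` to zero. -/
def psi {R ι : Type*} [Zero R] [DecidableEq ι] (J K : Finset ι) (s : K → R) : K → R :=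
  fun k => if (k : ι) ∈ J then s k else 0

/-- The coefficient `μ_α = (-1)^(|α|-1) (|α|-1)!` of a partition `α` of a (nonempty) set `K`. -/
def mu {ι : Type*} [DecidableEq ι] {K : Finset ι} (α : Finpartition K) : ℂ :=
  (-1) ^ (α.parts.card - 1) * ((α.parts.card - 1)! : ℂ)

/-- The non-linear operator `Λ_K(h) = ∑_{α ∈ Π_K} μ_α ∏_{J ∈ α} h ∘ ψ_{J,K}`. -/
def Lambda {R ι : Type*} [Zero R] [DecidableEq ι] (K : Finset ι) (h : (K → R) → ℂ)
    (s : K → R) : ℂ :=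
  ∑ α : Finpartition K, mu α * ∏ J ∈ α.parts, h (psi J K s)

/-- The integral
`∫_{‖t_K‖ ≤ T} |(Λ_K(f ∘ χ_{K,L})(t_K) - Λ_K(g ∘ χ_{K,L})(t_K)) / ∏_{k ∈ K} t_k| dt_K`
as an element of `[0, ∞]`; the norm on `K → ℝ` is the maximum norm. -/
def lambdaIntegral {ι : Type*} [DecidableEq ι] (f g : (ι → ℝ) → ℂ) (K : Finset ι) (T : ℝ) :
    ℝ≥0∞ :=
  ∫⁻ t in {t : K → ℝ | ‖t‖ ≤ T},
    ‖(Lambda K (f ∘ chi K) t - Lambda K (g ∘ chi K) t) / ∏ k, (t k : ℂ)‖ₑ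

/-- The supremum of the partial derivative of `F` with respect to the `j`-th coordinate, as an
element of `[0, ∞]`. (For a differentiable distribution function, which is non-decreasing in every
variable, the partial derivatives are nonnegative.) -/
def supPartial {ι : Type*} [Fintype ι] [DecidableEq ι] (F : (ι → ℝ) → ℝ) (j : ι) : ℝ≥0∞ :=
  ⨆ y : ι → ℝ, ENNReal.ofReal (fderiv ℝ F y (Pi.single j 1))

end BerryEsseen

end

/-! For a finite set `K` and numbers `a J`, the polynomial `∑ mu α ∏ a J` is the moment-to-cumulant
formula. With `a J = E ∏_{k ∈ J} Z_k` it is the joint cumulant of the variables `Z_k`, so `Λ_K(φ_X ∘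
χ)(t)` is the joint cumulant of the characters `exp(i t_k X_k)`, `k ∈ K`.

Smooth both vectors by adding independent Fejér noise divided by `T`. Given `X = x`, the smoothed
vector lies in a box `(a, b]` with probability `∏ g_k(x_k)`, and each `g_k` is a superposition `∫
w_k(t) exp(i t x) dt` with `w_k` supported in `[-T, T]` and `|w_k(t)| ≤ c / |t|`
(`fejerMeasure_real_eq_integral`, `norm_fejerWeight_le`). Cumulants are multilinear, so the cumulant
of the `g_k(X_k)` is the integral of `∏ w_k(t_k)` against `Λ_K` (`cumulantPoly_eq_integral`); hence
the cumulants for `X` and `Y` differ by at most `c ^ |K|` times the integral in the theorem. Moments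
are polynomials in cumulants, Lipschitz for moments in the unit disc (`exists_sub_le_cumulantPoly`),
which bounds the difference of the box probabilities. The bound does not depend on `a`, so `a → -∞`
gives the smoothed distribution functions.

To remove the smoothing, evaluate the smoothed difference at a point shifted by `r / T`.
Monotonicity of `F_X` and the Lipschitz bound on `F_Y` control the average over noise of norm at
most `r`; the rest is bounded by a fraction of the supremum and absorbed (`abs_cdf_sub_le`).

For finiteness, a joint cumulant of at least two variables vanishes if one of them is the constant
`1` (`cumulantPoly_eq_zero`). With first moments, setting `t_k = 0` costs `O(|t_k|)`, so the
difference of the `Λ_K` is at most `D min_k |t_k|`, hence at most `D ∏ |t_k| ^ (1/|K|)`, and the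
quotient is integrable (`lambdaIntegral_lt_top`). -/

namespace BerryEsseen

/-! ### Set partitions and the algebra of moments and cumulants. -/

section Partitions

variable {ι : Type*} [DecidableEq ι]

/-- Split the element `k` off its block. -/
def splitOff {K : Finset ι} (α : Finpartition K) {k : ι} (hk : k ∈ K) (h : {k} ∉ α.parts) :
    Finpartition K :=
  Finpartition.ofExistsUnique
    (insert {k} (insert ((α.part k).erase k) (α.parts.erase (α.part k))))
    (by
      intro p hp
      simp only [Finset.mem_insert, Finset.mem_erase] at hp
      rcases hp with rfl | rfl | hp
      · simpa using hk
      · exact (Finset.erase_subset _ _).trans (α.part_subset k)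
      · exact α.subset hp.2)
    (by
      intro x hx
      by_cases hxk : x = k
      · subst hxk
        refine ⟨{x}, by simp, ?_⟩
        rintro p ⟨hp, hxp⟩
        simp only [Finset.mem_insert, Finset.mem_erase] at hp
        rcases hp with rfl | rfl | hp
        · rfl
        · simp at hxp
        · exact absurd (α.part_eq_of_mem hp.2 hxp).symm hp.1
      · by_cases hxp : x ∈ α.part k
        · refine ⟨(α.part k).erase k, by simp [hxp, hxk], ?_⟩
          rintro p ⟨hp, hxp'⟩
          simp only [Finset.mem_insert, Finset.mem_erase] at hp
          rcases hp with rfl | rfl | hp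
          · simp [hxk] at hxp'
          · rfl
          · exact absurd (α.eq_of_mem_parts hp.2 (α.part_mem.2 hk) hxp' hxp) hp.1
        · refine ⟨α.part x, ⟨?_, α.mem_part hx⟩, ?_⟩
          · simp only [Finset.mem_insert, Finset.mem_erase]
            refine Or.inr (Or.inr ⟨?_, α.part_mem.2 hx⟩)
            intro h
            exact hxp (h ▸ α.mem_part hx)
          · rintro p ⟨hp, hxp'⟩
            simp only [Finset.mem_insert, Finset.mem_erase] at hp
            rcases hp with rfl | rfl | hp
            · simp [hxk] at hxp'
            · exact absurd (Finset.mem_of_mem_erase hxp') hxp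
            · exact (α.part_eq_of_mem hp.2 hxp').symm)
    (by
      intro h0
      simp only [Finset.mem_insert, Finset.mem_erase] at h0
      rcases h0 with h0 | h0 | h0
      · exact (Finset.singleton_ne_empty k) h0.symm
      · rcases (Finset.erase_eq_empty_iff _ _).1 h0.symm with h1 | h1
        · exact α.part_eq_empty.1 h1 hk
        · exact h (h1 ▸ α.part_mem.2 hk)
      · exact α.empty_notMem_parts h0.2)

/-- Merge the singleton block `{k}` with another block. -/
def mergeInto {K : Finset ι} (γ : Finpartition K) {k : ι} (hk : {k} ∈ γ.parts) {C : Finset ι}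
    (hC : C ∈ γ.parts.erase {k}) : Finpartition K :=
  have hkK : k ∈ K := by simpa using γ.subset hk
  have hC' := Finset.mem_erase.1 hC
  Finpartition.ofExistsUnique
    (insert (insert k C) ((γ.parts.erase {k}).erase C))
    (by
      intro p hp
      simp only [Finset.mem_insert, Finset.mem_erase] at hp
      rcases hp with rfl | hp
      · exact Finset.insert_subset hkK (γ.subset hC'.2)
      · exact γ.subset hp.2.2)
    (by
      intro x hx
      by_cases hxC : x ∈ insert k C
      · refine ⟨insert k C, by simpa using hxC, ?_⟩
        rintro p ⟨hp, hxp⟩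
        simp only [Finset.mem_insert, Finset.mem_erase] at hp hxC
        rcases hp with rfl | hp
        · rfl
        · rcases hxC with rfl | hxC
          · exact absurd (γ.eq_of_mem_parts hp.2.2 hk hxp (by simp)) hp.2.1
          · exact absurd (γ.eq_of_mem_parts hp.2.2 hC'.2 hxp hxC) hp.1
      · simp only [Finset.mem_insert, not_or] at hxC
        refine ⟨γ.part x, ⟨?_, γ.mem_part hx⟩, ?_⟩
        · simp only [Finset.mem_insert, Finset.mem_erase]
          refine Or.inr ⟨?_, ?_, γ.part_mem.2 hx⟩
          · intro h
            exact hxC.2 (h ▸ γ.mem_part hx)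
          · intro h
            exact hxC.1 (Finset.mem_singleton.1 (h ▸ γ.mem_part hx))
        · rintro p ⟨hp, hxp⟩
          simp only [Finset.mem_insert, Finset.mem_erase] at hp
          rcases hp with rfl | hp
          · simp [hxC] at hxp
          · exact (γ.part_eq_of_mem hp.2.2 hxp).symm)
    (by
      intro h0
      simp only [Finset.mem_insert, Finset.mem_erase] at h0
      rcases h0 with h0 | h0
      · exact (Finset.insert_ne_empty k C) h0.symm
      · exact γ.empty_notMem_parts h0.2.2)

lemma parts_splitOff {K : Finset ι} (α : Finpartition K) {k : ι} (hk : k ∈ K)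
    (h : {k} ∉ α.parts) : (splitOff α hk h).parts =
      insert {k} (insert ((α.part k).erase k) (α.parts.erase (α.part k))) := rfl

lemma parts_mergeInto {K : Finset ι} (γ : Finpartition K) {k : ι} (hk : {k} ∈ γ.parts)
    {C : Finset ι} (hC : C ∈ γ.parts.erase {k}) : (mergeInto γ hk hC).parts =
      insert (insert k C) ((γ.parts.erase {k}).erase C) := rfl

lemma erase_part_notMem {K : Finset ι} (α : Finpartition K) {k : ι} (hk : k ∈ K) : (α.part k).erase k ∉ α.parts.erase (α.part k) := by
  intro hm
  have hm' := Finset.mem_erase.1 hm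
  obtain ⟨x, hx⟩ := α.nonempty_of_mem_parts hm'.2
  exact hm'.1 (α.eq_of_mem_parts hm'.2 (α.part_mem.2 hk) hx (Finset.mem_of_mem_erase hx))

lemma singleton_notMem_insert {K : Finset ι} (α : Finpartition K) {k : ι}
    (h : {k} ∉ α.parts) :
    {k} ∉ insert ((α.part k).erase k) (α.parts.erase (α.part k)) := by
  simp only [Finset.mem_insert, Finset.mem_erase, not_or]
  refine ⟨fun h1 => ?_, fun h1 => h h1.2⟩
  have : k ∈ (α.part k).erase k := h1 ▸ Finset.mem_singleton_self k
  simp at this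

lemma prod_splitOff {K : Finset ι} (α : Finpartition K) {k : ι} (hk : k ∈ K)
    (h : {k} ∉ α.parts) (a : Finset ι → ℂ) (ha : a {k} = 1)
    (hak : ∀ J, a (J.erase k) = a J) :
    ∏ J ∈ (splitOff α hk h).parts, a J = ∏ J ∈ α.parts, a J := by
  rw [parts_splitOff, Finset.prod_insert (singleton_notMem_insert α h),
    Finset.prod_insert (erase_part_notMem α hk), ha, one_mul, hak,
    Finset.mul_prod_erase _ _ (α.part_mem.2 hk)]

lemma card_splitOff {K : Finset ι} (α : Finpartition K) {k : ι} (hk : k ∈ K)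
    (h : {k} ∉ α.parts) : (splitOff α hk h).parts.card = α.parts.card + 1 := by
  rw [parts_splitOff, Finset.card_insert_of_notMem (singleton_notMem_insert α h),
    Finset.card_insert_of_notMem (erase_part_notMem α hk),
    Finset.card_erase_add_one (α.part_mem.2 hk)]

lemma insert_notMem_of_mem_erase {K : Finset ι} (γ : Finpartition K) {k : ι} (hk : {k} ∈ γ.parts)
    {C : Finset ι} : insert k C ∉ (γ.parts.erase {k}) := by
  intro h
  have h' := Finset.mem_erase.1 h
  exact h'.1 (γ.eq_of_mem_parts h'.2 hk (Finset.mem_insert_self k C) (by simp))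

lemma notMem_of_mem_erase {K : Finset ι} (γ : Finpartition K) {k : ι} (hk : {k} ∈ γ.parts)
    {C : Finset ι} (hC : C ∈ γ.parts.erase {k}) : k ∉ C := by
  intro h
  have h' := Finset.mem_erase.1 hC
  exact h'.1 (γ.eq_of_mem_parts h'.2 hk h (by simp))

lemma part_mergeInto {K : Finset ι} (γ : Finpartition K) {k : ι} (hk : {k} ∈ γ.parts)
    {C : Finset ι} (hC : C ∈ γ.parts.erase {k}) : (mergeInto γ hk hC).part k = insert k C :=
  Finpartition.part_eq_of_mem _ (by rw [parts_mergeInto]; exact Finset.mem_insert_self _ _)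
    (Finset.mem_insert_self _ _)

lemma singleton_notMem_mergeInto {K : Finset ι} (γ : Finpartition K) {k : ι} (hk : {k} ∈ γ.parts)
    {C : Finset ι} (hC : C ∈ γ.parts.erase {k}) : {k} ∉ (mergeInto γ hk hC).parts := by
  intro h
  have h1 := (mergeInto γ hk hC).part_eq_of_mem h (Finset.mem_singleton_self k)
  rw [part_mergeInto] at h1
  obtain ⟨x, hx⟩ := γ.nonempty_of_mem_parts (Finset.mem_of_mem_erase hC)
  have h2 : x = k := Finset.mem_singleton.1 (h1 ▸ Finset.mem_insert_of_mem hx)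
  exact notMem_of_mem_erase γ hk hC (h2 ▸ hx)

lemma mergeInto_splitOff {K : Finset ι} (α : Finpartition K) {k : ι} (hk : k ∈ K)
    (h : {k} ∉ α.parts) (h1 : {k} ∈ (splitOff α hk h).parts)
    (h2 : (α.part k).erase k ∈ (splitOff α hk h).parts.erase {k}) :
    mergeInto (splitOff α hk h) h1 h2 = α := by
  ext1
  rw [parts_mergeInto, parts_splitOff, Finset.erase_insert (singleton_notMem_insert α h),
    Finset.erase_insert (erase_part_notMem α hk), Finset.insert_erase (α.mem_part hk),
    Finset.insert_erase (α.part_mem.2 hk)]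

lemma splitOff_mergeInto {K : Finset ι} (γ : Finpartition K) {k : ι} (hk : {k} ∈ γ.parts)
    {C : Finset ι} (hC : C ∈ γ.parts.erase {k}) (hkK : k ∈ K)
    (h : {k} ∉ (mergeInto γ hk hC).parts) :
    splitOff (mergeInto γ hk hC) hkK h = γ := by
  ext1
  rw [parts_splitOff, part_mergeInto, parts_mergeInto,
    Finset.erase_insert (notMem_of_mem_erase γ hk hC),
    Finset.erase_insert (fun h => insert_notMem_of_mem_erase γ hk (Finset.mem_of_mem_erase h)),
    Finset.insert_erase hC, Finset.insert_erase hk]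

/-- The polynomial in the values of `a` underlying the operator `Λ_K`. -/
noncomputable def cumulantPoly (K : Finset ι) (a : Finset ι → ℂ) : ℂ :=
  ∑ α : Finpartition K, mu α * ∏ J ∈ α.parts, a J

/-- A joint cumulant with a constant entry vanishes. Splitting `k` off its block does not change the
product, and it matches the partitions without block `{k}` with pairs of a partition `γ ∋ {k}` and
another block `C` of `γ` into which `k` is merged back. So `γ` collects `|γ| - 1` terms with
coefficient `(-1)^(|γ|-2) (|γ|-2)!`, which cancel its own coefficient. -/
theorem cumulantPoly_eq_zero {K : Finset ι} {k : ι} (hk : k ∈ K) (hK : K ≠ {k})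
    (a : Finset ι → ℂ) (ha : a {k} = 1) (hak : ∀ J, a (J.erase k) = a J) :
    cumulantPoly K a = 0 := by
  classical
  have key : ∑ α : Finpartition K with {k} ∉ α.parts, mu α * ∏ J ∈ α.parts, a J =
      ∑ γ : Finpartition K with {k} ∈ γ.parts, ∑ _C ∈ γ.parts.erase {k},
        ((-1) ^ (γ.parts.card - 1 - 1) * ((γ.parts.card - 1 - 1)! : ℂ)) *
          ∏ J ∈ γ.parts, a J := by
    rw [Finset.sum_sigma']
    refine Finset.sum_bij'
      (fun α hα => ⟨splitOff α hk (Finset.mem_filter.1 hα).2, (α.part k).erase k⟩)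
      (fun p hp => mergeInto p.1 (Finset.mem_filter.1 (Finset.mem_sigma.1 hp).1).2
        (Finset.mem_sigma.1 hp).2) ?_ ?_ ?_ ?_ ?_
    · intro α hα
      have hα' := (Finset.mem_filter.1 hα).2
      rw [Finset.mem_sigma, Finset.mem_filter]
      refine ⟨⟨Finset.mem_univ _, ?_⟩, ?_⟩
      · rw [parts_splitOff]; exact Finset.mem_insert_self _ _
      · rw [parts_splitOff, Finset.erase_insert (singleton_notMem_insert α hα')]
        exact Finset.mem_insert_self _ _
    · rintro ⟨γ, C⟩ hp
      exact Finset.mem_filter.2 ⟨Finset.mem_univ _, singleton_notMem_mergeInto _ _ _⟩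
    · intro α hα
      exact mergeInto_splitOff α hk (Finset.mem_filter.1 hα).2 _ _
    · rintro ⟨γ, C⟩ hp
      have h1 := (Finset.mem_filter.1 (Finset.mem_sigma.1 hp).1).2
      have h2 := (Finset.mem_sigma.1 hp).2
      refine Sigma.ext (splitOff_mergeInto γ h1 h2 hk (singleton_notMem_mergeInto γ h1 h2)) (heq_of_eq ?_)
      change ((mergeInto γ h1 h2).part k).erase k = C
      rw [part_mergeInto, Finset.erase_insert (notMem_of_mem_erase γ h1 h2)]
    · intro α hα
      have hα' := (Finset.mem_filter.1 hα).2
      change _ = _ * ∏ J ∈ (splitOff α hk hα').parts, a J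
      rw [prod_splitOff α hk hα' a ha hak, mu, card_splitOff]
      rfl
  rw [cumulantPoly, ← Finset.sum_filter_add_sum_filter_not _ (fun α : Finpartition K => {k} ∈ α.parts),
    key, ← Finset.sum_add_distrib]
  refine Finset.sum_eq_zero fun γ hγ => ?_
  have hγ' := (Finset.mem_filter.1 hγ).2
  -- This is where `K ≠ {k}` enters: `γ` needs a block besides `{k}`, otherwise there is nothing to
  -- cancel against and the truncated exponent `|γ| - 2` is wrong.
  have hcard : 2 ≤ γ.parts.card := by
    by_contra! hlt
    have h1 : γ.parts.card = 1 := le_antisymm (by omega) (Finset.card_pos.2 ⟨_, hγ'⟩)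
    obtain ⟨s, hs⟩ := Finset.card_eq_one.1 h1
    have h2 : γ.parts = {{k}} := by
      rw [hs] at hγ' ⊢
      rw [Finset.mem_singleton.1 hγ']
    apply hK
    rw [← γ.biUnion_parts, h2]
    simp
  obtain ⟨n, hn⟩ := Nat.exists_eq_add_of_le hcard
  rw [Finset.sum_const, Finset.card_erase_of_mem hγ', mu, hn, nsmul_eq_mul]
  have e1 : 2 + n - 1 = n + 1 := by omega
  have e2 : n + 1 - 1 = n := by omega
  rw [e1, e2, Nat.factorial_succ, pow_succ]
  push_cast
  ring

lemma Lambda_eq_cumulantPoly {R : Type*} [Zero R] (K : Finset ι) (h : (K → R) → ℂ) (s : K → R) :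
    Lambda K h s = cumulantPoly K fun J => h (psi J K s) := rfl

/-- A product over a partition's blocks is Lipschitz in entries from the unit ball. -/
lemma norm_prod_sub_prod_le {κ : Type*} (s : Finset κ) (a b : κ → ℂ) (ha : ∀ i ∈ s, ‖a i‖ ≤ 1)
    (hb : ∀ i ∈ s, ‖b i‖ ≤ 1) :
    ‖∏ i ∈ s, a i - ∏ i ∈ s, b i‖ ≤ ∑ i ∈ s, ‖a i - b i‖ := by
  classical
  induction s using Finset.induction_on with
  | empty => simp
  | insert i s hi ih =>
    rw [Finset.prod_insert hi, Finset.prod_insert hi, Finset.sum_insert hi]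
    have hp : ‖∏ j ∈ s, a j‖ ≤ 1 := by
      rw [norm_prod]
      exact Finset.prod_le_one (fun _ _ => norm_nonneg _)
        fun j hj => ha j (Finset.mem_insert_of_mem hj)
    have ih' := ih (fun j hj => ha j (Finset.mem_insert_of_mem hj))
      fun j hj => hb j (Finset.mem_insert_of_mem hj)
    calc ‖a i * ∏ j ∈ s, a j - b i * ∏ j ∈ s, b j‖
        = ‖(a i - b i) * ∏ j ∈ s, a j + b i * (∏ j ∈ s, a j - ∏ j ∈ s, b j)‖ := by
          congr 1; ring
      _ ≤ ‖a i - b i‖ * ‖∏ j ∈ s, a j‖ + ‖b i‖ * ‖∏ j ∈ s, a j - ∏ j ∈ s, b j‖ := by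
          rw [← norm_mul, ← norm_mul]; exact norm_add_le _ _
      _ ≤ ‖a i - b i‖ * 1 + 1 * ‖∏ j ∈ s, a j - ∏ j ∈ s, b j‖ := by
          gcongr
          exact hb i (Finset.mem_insert_self i s)
      _ ≤ _ := by linarith

lemma norm_cumulantPoly_sub_le (K : Finset ι) :
    ∃ C : ℝ, 0 ≤ C ∧ ∀ (a b : Finset ι → ℂ) (D : ℝ), (∀ J, ‖a J‖ ≤ 1) → (∀ J, ‖b J‖ ≤ 1) →
      (∀ J, ‖a J - b J‖ ≤ D) → ‖cumulantPoly K a - cumulantPoly K b‖ ≤ C * D := by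
  refine ⟨∑ α : Finpartition K, ‖mu α‖ * α.parts.card, by positivity, ?_⟩
  intro a b D ha hb hD
  rw [cumulantPoly, cumulantPoly, ← Finset.sum_sub_distrib, Finset.sum_mul]
  refine (norm_sum_le _ _).trans (Finset.sum_le_sum fun α _ => ?_)
  rw [← mul_sub, norm_mul, mul_assoc]
  gcongr
  refine (norm_prod_sub_prod_le _ _ _ (fun i _ => ha i) fun i _ => hb i).trans ?_
  rw [← nsmul_eq_mul]
  exact Finset.sum_le_card_nsmul _ _ _ fun J _ => hD J

lemma mu_indiscrete {K : Finset ι} (hK : K ≠ ⊥) : mu (Finpartition.indiscrete hK) = 1 := by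
  simp [mu]

/-- The one-block partition contributes `a K` with coefficient `1`; all other terms involve only
blocks strictly inside `K`. Solving for `a K` expresses it by the cumulant of `K` and values on
smaller sets, so induction on the cardinality applies. -/
lemma exists_sub_le_cumulantPoly_aux (n : ℕ) [Fintype ι] :
    ∃ C : ℝ, 0 ≤ C ∧ ∀ (a b : Finset ι → ℂ), (∀ J, ‖a J‖ ≤ 1) → (∀ J, ‖b J‖ ≤ 1) →
      ∀ K : Finset ι, K.Nonempty → K.card ≤ n → ‖a K - b K‖ ≤
        C * ∑ J : Finset ι with J.Nonempty, ‖cumulantPoly J a - cumulantPoly J b‖ := by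
  have hN0 : ∀ (C : ℝ), 0 ≤ C → ∀ (K : Finset ι) (α : Finpartition K),
      0 ≤ ‖mu α‖ * (α.parts.card * C) :=
    fun C hC K α => mul_nonneg (norm_nonneg _) (mul_nonneg (Nat.cast_nonneg _) hC)
  induction n with
  | zero =>
    refine ⟨0, le_rfl, fun a b _ _ K hK h0 => ?_⟩
    exact absurd (Finset.card_pos.2 hK) (by omega)
  | succ n ih =>
    obtain ⟨C, hC, ih⟩ := ih
    -- The `1` pays for the cumulant of `K` itself; summing over all sets makes the constant uniform
    -- in `K`.
    refine ⟨1 + ∑ K : Finset ι, ∑ α : Finpartition K, ‖mu α‖ * (α.parts.card * C),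
      add_nonneg zero_le_one (Finset.sum_nonneg fun K _ => Finset.sum_nonneg fun α _ =>
        hN0 C hC K α), fun a b ha hb K hK hn => ?_⟩
    set S := ∑ J : Finset ι with J.Nonempty, ‖cumulantPoly J a - cumulantPoly J b‖ with hS
    have hS0 : 0 ≤ S := Finset.sum_nonneg fun _ _ => norm_nonneg _
    have hKS : ‖cumulantPoly K a - cumulantPoly K b‖ ≤ S :=
      Finset.single_le_sum (f := fun J => ‖cumulantPoly J a - cumulantPoly J b‖)
        (fun _ _ => norm_nonneg _) (Finset.mem_filter.2 ⟨Finset.mem_univ K, hK⟩)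
    have hK' : K ≠ ⊥ := hK.ne_empty
    have hdec : ∀ c : Finset ι → ℂ, c K = cumulantPoly K c -
        ∑ α ∈ Finset.univ.erase (Finpartition.indiscrete hK'), mu α * ∏ J ∈ α.parts, c J := by
      intro c
      rw [cumulantPoly, ← Finset.add_sum_erase _ _ (Finset.mem_univ (Finpartition.indiscrete hK')),
        mu_indiscrete, one_mul, Finpartition.indiscrete_parts, Finset.prod_singleton,
        add_sub_cancel_right]
    have hmain : ‖∑ α ∈ Finset.univ.erase (Finpartition.indiscrete hK'), mu α * ∏ J ∈ α.parts, a J -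
        ∑ α ∈ Finset.univ.erase (Finpartition.indiscrete hK'), mu α * ∏ J ∈ α.parts, b J‖ ≤
        ∑ α ∈ Finset.univ.erase (Finpartition.indiscrete hK'), ‖mu α‖ * (α.parts.card * C) * S := by
      rw [← Finset.sum_sub_distrib]
      refine (norm_sum_le _ _).trans (Finset.sum_le_sum fun α hα => ?_)
      rw [← mul_sub, norm_mul, mul_assoc]
      gcongr
      refine (norm_prod_sub_prod_le _ _ _ (fun i _ => ha i) fun i _ => hb i).trans ?_
      rw [mul_assoc, ← nsmul_eq_mul]
      refine Finset.sum_le_card_nsmul _ _ _ fun J hJ => ih a b ha hb J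
        (α.nonempty_of_mem_parts hJ) ?_
      have hJK : J ⊂ K := by
        refine (α.subset hJ).ssubset_of_ne ?_
        rintro rfl
        refine (Finset.mem_erase.1 hα).1 ?_
        ext1
        refine Finset.eq_singleton_iff_unique_mem.2 ⟨hJ, fun I hI => ?_⟩
        obtain ⟨x, hx⟩ := α.nonempty_of_mem_parts hI
        exact α.eq_of_mem_parts hI hJ hx (α.subset hI hx)
      have := Finset.card_lt_card hJK
      omega
    have hle : ∑ α ∈ Finset.univ.erase (Finpartition.indiscrete hK'),
        ‖mu α‖ * (α.parts.card * C) * S ≤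
        (∑ K : Finset ι, ∑ α : Finpartition K, ‖mu α‖ * (α.parts.card * C)) * S := by
      rw [← Finset.sum_mul]
      refine mul_le_mul_of_nonneg_right ?_ hS0
      refine le_trans ?_ (Finset.single_le_sum
        (f := fun K : Finset ι => ∑ α : Finpartition K, ‖mu α‖ * (α.parts.card * C))
        (fun K _ => Finset.sum_nonneg fun α _ => hN0 C hC K α) (Finset.mem_univ K))
      exact Finset.sum_le_sum_of_subset_of_nonneg (Finset.erase_subset _ _)
        fun α _ _ => hN0 C hC K α
    rw [hdec a, hdec b, sub_sub_sub_comm]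
    refine (norm_sub_le _ _).trans ?_
    rw [add_mul, one_mul]
    exact add_le_add hKS (hmain.trans hle)

/-- The values of a function on nonempty sets are Lipschitz functions of its cumulant
polynomials. -/
theorem exists_sub_le_cumulantPoly [Fintype ι] :
    ∃ C : ℝ, 0 ≤ C ∧ ∀ (a b : Finset ι → ℂ), (∀ J, ‖a J‖ ≤ 1) → (∀ J, ‖b J‖ ≤ 1) →
      ∀ K : Finset ι, K.Nonempty → ‖a K - b K‖ ≤
        C * ∑ J : Finset ι with J.Nonempty, ‖cumulantPoly J a - cumulantPoly J b‖ := by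
  obtain ⟨C, hC, h⟩ := exists_sub_le_cumulantPoly_aux (ι := ι) (Fintype.card ι)
  exact ⟨C, hC, fun a b ha hb K hK => h a b ha hb K hK (Finset.card_le_univ K)⟩

end Partitions

/-! ### The Fejér kernel and band-limited smoothing of interval indicators. -/

section Kernel

open Complex in
lemma intervalIntegral_one_sub_mul_exp {c : ℂ} (hc : c ≠ 0) :
    ∫ s : ℝ in (0 : ℝ)..1, (1 - (s : ℂ)) * exp (c * s) = exp c / c ^ 2 - 1 / c - 1 / c ^ 2 := by
  have hd : ∀ s : ℝ, HasDerivAt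
      (fun s : ℝ => (1 - (s : ℂ)) * exp (c * s) / c + exp (c * s) / c ^ 2)
      ((1 - (s : ℂ)) * exp (c * s)) s := by
    intro s
    have h1 : HasDerivAt (fun s : ℝ => (s : ℂ)) 1 s := ofRealCLM.hasDerivAt
    have h2 : HasDerivAt (fun s : ℝ => exp (c * s)) (exp (c * s) * (c * 1)) s :=
      (h1.const_mul c).cexp
    have h3 := ((h1.const_sub 1).mul h2).div_const c |>.add (h2.div_const (c ^ 2))
    refine h3.congr_deriv ?_
    field_simp
    ring
  rw [intervalIntegral.integral_eq_sub_of_hasDerivAt (fun s _ => hd s)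
    ((by fun_prop : Continuous fun s : ℝ => (1 - (s : ℂ)) * exp (c * s)).intervalIntegrable _ _)]
  simp
  ring

/-- The triangular function supported by `[-1, 1]`. -/
noncomputable def tri (s : ℝ) : ℝ := max 0 (1 - |s|)

lemma continuous_tri : Continuous tri := by unfold tri; fun_prop

lemma tri_nonneg (s : ℝ) : 0 ≤ tri s := le_max_left _ _

lemma tri_le_one (s : ℝ) : tri s ≤ 1 := max_le zero_le_one (by linarith [abs_nonneg s])

lemma tri_eq_zero {s : ℝ} (hs : 1 ≤ |s|) : tri s = 0 := max_eq_left (by linarith)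

lemma integrable_tri : Integrable tri := by
  refine continuous_tri.integrable_of_hasCompactSupport
    (HasCompactSupport.intro (isCompact_Icc (a := (-1 : ℝ)) (b := 1)) fun s hs => tri_eq_zero ?_)
  by_contra! h
  exact hs ⟨(abs_lt.1 h).1.le, (abs_lt.1 h).2.le⟩

/-- The Fejér kernel, up to normalization. -/
noncomputable def fejer (u : ℝ) : ℝ := Real.sinc (u / 2) ^ 2

lemma continuous_fejer : Continuous fejer := by
  unfold fejer
  exact (Real.continuous_sinc.comp (by fun_prop)).pow 2

lemma fejer_nonneg (u : ℝ) : 0 ≤ fejer u := sq_nonneg _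

lemma integrable_fejer : Integrable fejer := by
  -- The `5` is `1 + 4`, from `fejer u ≤ 1` and `fejer u * u ^ 2 ≤ 4`.
  refine (integrable_inv_one_add_sq.const_mul 5).mono' continuous_fejer.aestronglyMeasurable
    (Filter.Eventually.of_forall fun u => ?_)
  rw [Real.norm_of_nonneg (fejer_nonneg u), ← div_eq_mul_inv, le_div_iff₀ (by positivity)]
  have h1 : fejer u ≤ 1 := by
    rw [fejer, sq_le_one_iff_abs_le_one]
    exact Real.abs_sinc_le_one _
  have h2 : fejer u * u ^ 2 ≤ 4 := by
    rcases eq_or_ne u 0 with rfl | hu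
    · norm_num
    · rw [fejer, Real.sinc_of_ne_zero (by positivity), div_pow, div_pow]
      have : Real.sin (u / 2) ^ 2 / (u ^ 2 / 2 ^ 2) * u ^ 2 = 4 * Real.sin (u / 2) ^ 2 := by
        field_simp
        ring
      rw [this]
      nlinarith [Real.sin_sq_le_one (u / 2)]
  linarith

lemma integral_fejer_pos : 0 < ∫ u, fejer u := by
  rw [integral_pos_iff_support_of_nonneg fejer_nonneg integrable_fejer]
  refine (continuous_fejer.isOpen_support).measure_pos volume ⟨0, ?_⟩
  simp [fejer]

open Complex in
lemma fejer_eq_integral (u : ℝ) : (fejer u : ℂ) = ∫ s : ℝ, (tri s : ℂ) * exp (-(s * u * I)) := by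
  have h0 : ∫ s : ℝ, (tri s : ℂ) * exp (-(s * u * I)) =
      ∫ s : ℝ in (-1 : ℝ)..1, (tri s : ℂ) * exp (-(s * u * I)) := by
    rw [intervalIntegral.integral_of_le (by norm_num), ← integral_Icc_eq_integral_Ioc,
      setIntegral_eq_integral_of_forall_compl_eq_zero]
    intro s hs
    rw [tri_eq_zero, ofReal_zero, zero_mul]
    by_contra! h
    exact hs ⟨(abs_lt.1 h).1.le, (abs_lt.1 h).2.le⟩
  have hcont : Continuous fun s : ℝ => (tri s : ℂ) * exp (-(s * u * I)) :=
    (continuous_ofReal.comp continuous_tri).mul (by fun_prop)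
  have hpos : ∫ s : ℝ in (0 : ℝ)..1, (tri s : ℂ) * exp (-(s * u * I)) =
      ∫ s : ℝ in (0 : ℝ)..1, (1 - (s : ℂ)) * exp (-(u * I) * s) := by
    refine intervalIntegral.integral_congr fun s hs => ?_
    rw [Set.uIcc_of_le zero_le_one] at hs
    have : tri s = 1 - s := by
      rw [tri, abs_of_nonneg hs.1, max_eq_right (by linarith [hs.2])]
    simp only [this]
    push_cast
    congr 2
    ring
  have hneg : ∫ s : ℝ in (-1 : ℝ)..0, (tri s : ℂ) * exp (-(s * u * I)) =
      ∫ s : ℝ in (0 : ℝ)..1, (1 - (s : ℂ)) * exp ((u * I) * s) := by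
    have := intervalIntegral.integral_comp_neg
      (fun s : ℝ => (tri s : ℂ) * exp (-(s * u * I))) (a := 0) (b := 1)
    rw [neg_zero] at this
    rw [← this]
    refine intervalIntegral.integral_congr fun s hs => ?_
    rw [Set.uIcc_of_le zero_le_one] at hs
    have : tri (-s) = 1 - s := by
      rw [tri, abs_neg, abs_of_nonneg hs.1, max_eq_right (by linarith [hs.2])]
    simp only [this]
    push_cast
    congr 2
    ring
  rw [h0, ← intervalIntegral.integral_add_adjacent_intervals (b := 0)
    (hcont.intervalIntegrable _ _) (hcont.intervalIntegrable _ _), hpos, hneg]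
  rcases eq_or_ne u 0 with rfl | hu
  · have h1 : ∫ s : ℝ in (0 : ℝ)..1, (1 - (s : ℂ)) = 1 / 2 := by
      have : ∀ s : ℝ, (1 - (s : ℂ)) = ((1 - s : ℝ) : ℂ) := by intro s; push_cast; rfl
      simp_rw [this]
      rw [intervalIntegral.integral_ofReal]
      rw [intervalIntegral.integral_sub (by simp) (by simp)]
      simp
      norm_num
    simp [fejer, h1]
    norm_num
  · have hc : (u * I : ℂ) ≠ 0 := mul_ne_zero (ofReal_ne_zero.2 hu) I_ne_zero
    rw [intervalIntegral_one_sub_mul_exp hc, intervalIntegral_one_sub_mul_exp (neg_ne_zero.2 hc)]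
    have h2 : exp (u * I) + exp (-(u * I)) = 2 - 4 * (Real.sin (u / 2) : ℂ) ^ 2 := by
      have h3 : (Real.cos u : ℂ) = 1 - 2 * (Real.sin (u / 2) : ℂ) ^ 2 := by
        rw [← ofReal_pow]
        have : Real.cos u = 1 - 2 * Real.sin (u / 2) ^ 2 := by
          have := Real.cos_sq' (u / 2)
          have h := Real.cos_two_mul (u / 2)
          rw [mul_div_cancel₀ u two_ne_zero] at h
          rw [h, this]; ring
        rw [this]; push_cast; ring
      rw [show (2 : ℂ) - 4 * (Real.sin (u / 2) : ℂ) ^ 2 = 2 * Real.cos u by rw [h3]; ring,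
        ofReal_cos, two_cos, neg_mul]
    have hu' : (u : ℂ) ≠ 0 := ofReal_ne_zero.2 hu
    rw [fejer, Real.sinc_of_ne_zero (div_ne_zero hu two_ne_zero)]
    have hsq : (u * I : ℂ) ^ 2 = -u ^ 2 := by rw [mul_pow, I_sq]; ring
    have hrhs : exp (u * I) / (u * I) ^ 2 - 1 / (u * I) - 1 / (u * I) ^ 2 +
        (exp (-(u * I)) / (-(u * I)) ^ 2 - 1 / (-(u * I)) - 1 / (-(u * I)) ^ 2) =
        (exp (u * I) + exp (-(u * I)) - 2) / (u * I) ^ 2 := by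
      rw [neg_sq, div_neg]; ring
    rw [hrhs, h2, hsq]
    push_cast
    field_simp
    ring

/-- The Fejér distribution. -/
noncomputable def fejerMeasure : Measure ℝ :=
  volume.withDensity fun u => ENNReal.ofReal ((∫ v, fejer v)⁻¹ * fejer u)

instance isProbabilityMeasure_fejerMeasure : IsProbabilityMeasure fejerMeasure := by
  refine ⟨?_⟩
  rw [fejerMeasure, withDensity_apply _ MeasurableSet.univ, Measure.restrict_univ,
    ← ofReal_integral_eq_lintegral_ofReal (integrable_fejer.const_mul _)
      (Filter.Eventually.of_forall fun u =>
        mul_nonneg (inv_nonneg.2 integral_fejer_pos.le) (fejer_nonneg u)),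
    integral_const_mul, inv_mul_cancel₀ integral_fejer_pos.ne', ENNReal.ofReal_one]

lemma fejerMeasure_real_apply {s : Set ℝ} (hs : MeasurableSet s) :
    fejerMeasure.real s = (∫ v, fejer v)⁻¹ * ∫ u, s.indicator fejer u := by
  have h0 : ∀ u, 0 ≤ (∫ v, fejer v)⁻¹ * fejer u := fun u =>
    mul_nonneg (inv_nonneg.2 integral_fejer_pos.le) (fejer_nonneg u)
  rw [measureReal_def, fejerMeasure, withDensity_apply _ hs,
    ← ofReal_integral_eq_lintegral_ofReal (integrable_fejer.const_mul _).integrableOn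
      (Filter.Eventually.of_forall h0),
    ENNReal.toReal_ofReal (integral_nonneg h0), integral_const_mul, integral_indicator hs]

open Complex in
/-- The Fourier weight representing the smoothed indicator function of `(a, b]`. -/
noncomputable def fejerWeight (T a b t : ℝ) : ℂ :=
  ((∫ v, fejer v)⁻¹ * tri (t / T) : ℝ) * ((exp (-(t * a * I)) - exp (-(t * b * I))) / (t * I))

open Complex in
lemma intervalIntegral_exp_eq (a b : ℝ) {t : ℝ} (ht : t ≠ 0) :
    ∫ y : ℝ in a..b, exp (-(t * y * I)) =
      (exp (-(t * a * I)) - exp (-(t * b * I))) / (t * I) := by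
  have hc : (-(t * I) : ℂ) ≠ 0 := neg_ne_zero.2 (mul_ne_zero (ofReal_ne_zero.2 ht) I_ne_zero)
  have h : ∀ y : ℝ, exp (-(t * y * I)) = exp (-(t * I) * y) := fun y => by congr 1; ring
  simp_rw [h]
  rw [integral_exp_mul_complex hc, div_neg, ← neg_div, neg_sub]

open Complex in
lemma norm_exp_neg_mul_I (t a : ℝ) : ‖exp (-(t * a * I))‖ = 1 := by
  have : (-(t * a * I) : ℂ) = ((-(t * a) : ℝ) : ℂ) * I := by push_cast; ring
  rw [this, norm_exp_ofReal_mul_I]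

/-- Independence of `a` and `b` is the point: it lets the box grow to an orthant later and produces
the factor `1 / t_k` of the theorem. -/
lemma norm_fejerWeight_le (T a b t : ℝ) :
    ‖fejerWeight T a b t‖ ≤ (∫ v, fejer v)⁻¹ * 2 / |t| := by
  have hc := inv_nonneg.2 integral_fejer_pos.le
  rw [fejerWeight, norm_mul, norm_div, norm_mul, Complex.norm_I, mul_one, Complex.norm_real,
    Complex.norm_real, Real.norm_eq_abs t, mul_div_assoc,
    Real.norm_of_nonneg (mul_nonneg hc (tri_nonneg _))]
  refine mul_le_mul (mul_le_of_le_one_right hc (tri_le_one _)) ?_ (by positivity) hc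
  refine div_le_div_of_nonneg_right ((norm_sub_le _ _).trans ?_) (abs_nonneg t)
  rw [norm_exp_neg_mul_I, norm_exp_neg_mul_I]
  norm_num

lemma fejerWeight_eq_zero {T a b t : ℝ} (hT : 0 < T) (ht : T ≤ |t|) : fejerWeight T a b t = 0 := by
  have : tri (t / T) = 0 := by
    apply tri_eq_zero
    rwa [abs_div, abs_of_pos hT, one_le_div hT]
  rw [fejerWeight, this]
  simp

open Complex in
lemma fejerWeight_eq (T a b : ℝ) {t : ℝ} (ht : t ≠ 0) :
    fejerWeight T a b t =
      ((∫ v, fejer v)⁻¹ * tri (t / T) : ℝ) * ∫ y : ℝ in a..b, exp (-(t * y * I)) := by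
  rw [fejerWeight, intervalIntegral_exp_eq a b ht]

lemma measurable_fejerWeight (T a b : ℝ) : Measurable (fejerWeight T a b) := by
  have := continuous_tri.measurable
  unfold fejerWeight
  fun_prop

/-- The factor `1 / t` is harmless near `0` because the weight is also at most a constant times `|b
- a|`. This bound depends on the interval and serves only to justify Fubini. -/
lemma integrable_fejerWeight {T : ℝ} (hT : 0 < T) (a b : ℝ) : Integrable (fejerWeight T a b) := by
  have hc := inv_nonneg.2 integral_fejer_pos.le
  refine ((integrable_tri.comp_div hT.ne').const_mul ((∫ v, fejer v)⁻¹ * |b - a|)).mono'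
    (measurable_fejerWeight T a b).aestronglyMeasurable (Filter.Eventually.of_forall fun t => ?_)
  rcases eq_or_ne t 0 with rfl | ht
  · simp only [fejerWeight, Complex.ofReal_zero, zero_mul, div_zero, mul_zero, norm_zero]
    exact mul_nonneg (mul_nonneg hc (abs_nonneg _)) (tri_nonneg _)
  · rw [fejerWeight_eq _ _ _ ht, norm_mul, Complex.norm_real,
      Real.norm_of_nonneg (mul_nonneg hc (tri_nonneg _)), mul_right_comm _ |b - a|]
    refine mul_le_mul_of_nonneg_left ?_ (mul_nonneg hc (tri_nonneg _))
    simpa using intervalIntegral.norm_integral_le_of_norm_le_const (C := 1) (a := a) (b := b)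
      (f := fun y : ℝ => Complex.exp (-(t * y * Complex.I)))
      fun y _ => (norm_exp_neg_mul_I t y).le

open Complex in
/-- The smoothed indicator function of an interval is a superposition of characters of frequency
at most `T`. -/
theorem fejerMeasure_real_eq_integral {T : ℝ} (hT : 0 < T) {a b : ℝ} (hab : a ≤ b) (x : ℝ) :
    (fejerMeasure.real {u | a < x + u / T ∧ x + u / T ≤ b} : ℂ) =
      ∫ t : ℝ, fejerWeight T a b t * exp (t * x * I) := by
  have hms : MeasurableSet {u : ℝ | a < x + u / T ∧ x + u / T ≤ b} :=
    (by fun_prop : Measurable fun u : ℝ => x + u / T) measurableSet_Ioc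
  have hkey : ∀ s : ℝ, ∫ y : ℝ in a..b, (tri s : ℂ) * exp (-(s * (T * (y - x) : ℝ) * I)) =
      tri s * exp (s * T * x * I) * ∫ y : ℝ in a..b, exp (-(s * T * y * I)) := by
    intro s
    rw [← intervalIntegral.integral_const_mul]
    refine intervalIntegral.integral_congr fun y _ => ?_
    rw [mul_assoc (tri s : ℂ), ← exp_add]
    congr 2
    push_cast
    ring
  -- Substitution `y = x + u / T`. Afterwards the Fourier representation of `fejer` is inserted, the
  -- integrals are swapped, and `t = s * T` brings the frequencies to `[-T, T]`.
  have h1 : (∫ u, {u : ℝ | a < x + u / T ∧ x + u / T ≤ b}.indicator fejer u) =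
      T * ∫ y in a..b, fejer (T * (y - x)) := by
    rw [intervalIntegral.integral_of_le hab, ← integral_indicator measurableSet_Ioc]
    rw [← integral_sub_right_eq_self ((Set.Ioc a b).indicator _) (-x)]
    have := Measure.integral_comp_mul_left
      ({u : ℝ | a < x + u / T ∧ x + u / T ≤ b}.indicator fejer) T
    rw [smul_eq_mul, abs_of_pos (inv_pos.2 hT)] at this
    rw [← mul_inv_cancel_left₀ hT.ne' (∫ u, _), ← this]
    congr 1
    refine integral_congr_ae (Filter.Eventually.of_forall fun y => ?_)
    simp only [Set.indicator, Set.mem_ofPred_eq, Set.mem_Ioc, mul_div_cancel_left₀ _ hT.ne',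
      sub_neg_eq_add, add_sub_cancel_right, add_comm x y]
  have hswap : ∫ y : ℝ in a..b, ∫ s : ℝ, (tri s : ℂ) * exp (-(s * (T * (y - x) : ℝ) * I)) =
      ∫ s : ℝ, ∫ y : ℝ in a..b, (tri s : ℂ) * exp (-(s * (T * (y - x) : ℝ) * I)) := by
    refine intervalIntegral_integral_swap ?_
    have hfin : IsFiniteMeasure (volume.restrict (Set.uIoc a b)) :=
      ⟨by simp [Set.uIoc_of_le hab]⟩
    have hi : Integrable (fun p : ℝ × ℝ => tri p.2)
        ((volume.restrict (Set.uIoc a b)).prod volume) := integrable_tri.comp_snd _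
    refine hi.mono' ?_ (Filter.Eventually.of_forall fun p => ?_)
    · refine Continuous.aestronglyMeasurable ?_
      have := continuous_tri
      unfold Function.uncurry
      fun_prop
    · simp only [Function.uncurry]
      rw [norm_mul, norm_exp_neg_mul_I, mul_one, norm_real, Real.norm_of_nonneg (tri_nonneg _)]
  have h2 : ((∫ u, {u : ℝ | a < x + u / T ∧ x + u / T ≤ b}.indicator fejer u : ℝ) : ℂ) =
      T * ∫ s : ℝ, tri s * exp (s * T * x * I) *
        ∫ y : ℝ in a..b, exp (-(s * T * y * I)) := by
    rw [h1]
    push_cast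
    rw [← intervalIntegral.integral_ofReal]
    simp_rw [fejer_eq_integral]
    rw [hswap]
    simp_rw [hkey]
  have h3 := Measure.integral_comp_mul_right
    (fun t : ℝ => (tri (t / T) : ℂ) * exp (t * x * I) * ∫ y : ℝ in a..b, exp (-(t * y * I))) T
  rw [abs_of_pos (inv_pos.2 hT)] at h3
  simp only [mul_div_cancel_right₀ _ hT.ne'] at h3
  rw [fejerMeasure_real_apply hms]
  push_cast
  rw [h2]
  simp only [ofReal_mul] at h3 ⊢
  rw [h3, real_smul, ofReal_inv, mul_inv_cancel_left₀ (ofReal_ne_zero.2 hT.ne'),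
    ← integral_const_mul]
  refine integral_congr_ae ?_
  filter_upwards [Measure.ae_ne volume 0] with t ht
  rw [fejerWeight_eq _ _ _ ht]
  push_cast
  ring

end Kernel

/-! ### Cumulants of smoothed indicators as integrals of `Λ_K`. -/

section Cumulants

lemma integral_finset_prod_pi {κ E : Type*} [Fintype κ] [MeasurableSpace E] (μ : Measure E)
    [IsProbabilityMeasure μ] (s : Finset κ) (h : κ → E → ℂ) :
    ∫ y : κ → E, ∏ i ∈ s, h i (y i) ∂(Measure.pi fun _ => μ) = ∏ i ∈ s, ∫ x, h i x ∂μ := by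
  classical
  have := integral_fintype_prod_eq_prod (μ := fun _ : κ => μ)
    (fun i x => if i ∈ s then h i x else 1)
  simp only [Finset.prod_ite_mem, Finset.univ_inter] at this
  rw [this, ← Finset.prod_subset (Finset.subset_univ s)]
  · exact Finset.prod_congr rfl fun i hi => by simp [hi]
  · intro i _ hi
    simp [hi]

variable {ι : Type*}

lemma prod_parts_prod [DecidableEq ι] {K : Finset ι} (α : Finpartition K)
    (F : Finset ι → ι → ℂ) :
    ∏ J ∈ α.parts, ∏ k ∈ J, F J k = ∏ k : K, F (α.part k) k := by
  rw [Finset.prod_coe_sort K (fun k => F (α.part k) k)]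
  rw [← Finset.prod_congr α.biUnion_parts fun _ _ => rfl, Finset.prod_biUnion α.disjoint]
  refine Finset.prod_congr rfl fun J hJ => Finset.prod_congr rfl fun k hk => ?_
  rw [α.part_eq_of_mem hJ hk]

variable [Fintype ι]

/-- The characteristic function of a measure on `ι → ℝ`. -/
noncomputable def piCharFun (μ : Measure (ι → ℝ)) (t : ι → ℝ) : ℂ :=
  ∫ x, ∏ j, Complex.exp (t j * x j * Complex.I) ∂μ

lemma charFunVec_eq_piCharFun {Ω : Type*} [MeasurableSpace Ω] (P : Measure Ω) {X : Ω → ι → ℝ}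
    (hX : Measurable X) : charFunVec P X = piCharFun (P.map X) := by
  ext t
  rw [charFunVec, charFun_apply, integral_map (by fun_prop) (by fun_prop), piCharFun,
    integral_map hX.aemeasurable (Continuous.aestronglyMeasurable (by fun_prop))]
  refine integral_congr_ae (Filter.Eventually.of_forall fun ω => ?_)
  simp only [PiLp.inner_apply, ← Complex.exp_sum, ← Finset.sum_mul]
  simp

variable [DecidableEq ι]

lemma piCharFun_chi_psi (μ : Measure (ι → ℝ)) {J K : Finset ι} (hJ : J ⊆ K) (t : K → ℝ) :
    piCharFun μ (chi K (psi J K t)) =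
      ∫ x, ∏ j ∈ J, Complex.exp (chi K t j * x j * Complex.I) ∂μ := by
  rw [piCharFun]
  congr 1
  ext x
  rw [← Finset.prod_subset (Finset.subset_univ J)]
  · refine Finset.prod_congr rfl fun j hj => ?_
    simp [chi, psi, hj, hJ hj]
  · intro j _ hj
    simp [chi, psi, hj]

lemma norm_exp_mul_I (t a : ℝ) : ‖Complex.exp (t * a * Complex.I)‖ = 1 := by
  rw [← Complex.ofReal_mul, Complex.norm_exp_ofReal_mul_I]

variable (μ : Measure (ι → ℝ)) [IsProbabilityMeasure μ] {g w : ι → ℝ → ℂ}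

/-- A product over blocks of expectations is one expectation over independent copies of the vector.
There is a copy `y J` for every finset `J`, so the probability space is the same for all partitions;
coordinate `k` is read from the copy belonging to its block. -/
lemma integrable_fubini_kernel (hw : ∀ k, Integrable (w k)) {K : Finset ι}
    (α : Finpartition K) :
    Integrable (Function.uncurry fun (y : Finset ι → ι → ℝ) (t : K → ℝ) =>
      (∏ k : K, w k (t k)) * ∏ k : K, Complex.exp (t k * y (α.part k) k * Complex.I))
      ((Measure.pi fun _ : Finset ι => μ).prod volume) := by
  have h1 : Integrable (fun t : K → ℝ => ∏ k : K, w k (t k)) :=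
    Integrable.fintype_prod fun k : K => hw k
  have h2 : Integrable (fun p : (Finset ι → ι → ℝ) × (K → ℝ) => ∏ k : K, w k (p.2 k))
      ((Measure.pi fun _ : Finset ι => μ).prod volume) := h1.comp_snd _
  refine h2.mul_bdd (c := 1) ?_ (Filter.Eventually.of_forall fun p => ?_)
  · exact Continuous.aestronglyMeasurable (by fun_prop)
  · rw [norm_prod]
    exact Finset.prod_le_one (fun _ _ => norm_nonneg _) fun k _ => (norm_exp_mul_I _ _).le

lemma integral_fubini_kernel {K : Finset ι} (α : Finpartition K) (t : K → ℝ) :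
    ∫ y : Finset ι → ι → ℝ,
      (∏ k : K, w k (t k)) * ∏ k : K, Complex.exp (t k * y (α.part k) k * Complex.I)
        ∂(Measure.pi fun _ : Finset ι => μ) =
      (∏ k : K, w k (t k)) * ∏ J ∈ α.parts, piCharFun μ (chi K (psi J K t)) := by
  rw [integral_const_mul]
  congr 1
  rw [Finset.prod_congr rfl fun J hJ => piCharFun_chi_psi μ (α.subset hJ) t,
    ← integral_finset_prod_pi]
  refine integral_congr_ae (Filter.Eventually.of_forall fun y => ?_)
  simp only
  rw [prod_parts_prod α (fun J j => Complex.exp (chi K t j * y J j * Complex.I))]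
  refine Finset.prod_congr rfl fun k _ => ?_
  simp [chi]

lemma integrable_partition_term (hw : ∀ k, Integrable (w k)) {K : Finset ι}
    (α : Finpartition K) :
    Integrable fun t : K → ℝ =>
      (∏ k : K, w k (t k)) * ∏ J ∈ α.parts, piCharFun μ (chi K (psi J K t)) := by
  have := (integrable_fubini_kernel μ hw α).integral_prod_right
  simp only [Function.uncurry] at this
  simpa only [integral_fubini_kernel] using this

/-- Multilinearity of one term of the cumulant formula: Fubini for the independent copies `y` and
the frequencies `t`, where for fixed `y` the `t`-integral factors over the coordinates. -/
lemma integral_partition_term (hw : ∀ k, Integrable (w k))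
    (hg : ∀ k x, g k x = ∫ t : ℝ, w k t * Complex.exp (t * x * Complex.I)) {K : Finset ι}
    (α : Finpartition K) :
    ∏ J ∈ α.parts, ∫ x, ∏ k ∈ J, g k (x k) ∂μ = ∫ t : K → ℝ,
      (∏ k : K, w k (t k)) * ∏ J ∈ α.parts, piCharFun μ (chi K (psi J K t)) := by
  rw [← integral_finset_prod_pi]
  simp_rw [← integral_fubini_kernel μ α]
  rw [← integral_integral_swap (integrable_fubini_kernel μ hw α)]
  refine integral_congr_ae (Filter.Eventually.of_forall fun y => ?_)
  simp only
  rw [prod_parts_prod α (fun J k => g k (y J k))]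
  simp_rw [← Finset.prod_mul_distrib]
  rw [integral_fintype_prod_volume_eq_prod
    (fun (k : K) (s : ℝ) => w k s * Complex.exp (s * y (α.part k) k * Complex.I))]
  exact Finset.prod_congr rfl fun k _ => hg k _

/-- Applying the cumulant polynomials to smoothed probabilities amounts to applying the
operators `Λ_K` to characteristic functions. -/
theorem cumulantPoly_eq_integral (hw : ∀ k, Integrable (w k))
    (hg : ∀ k x, g k x = ∫ t : ℝ, w k t * Complex.exp (t * x * Complex.I)) (K : Finset ι) :
    cumulantPoly K (fun J => ∫ x, ∏ k ∈ J, g k (x k) ∂μ) =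
      ∫ t : K → ℝ, (∏ k : K, w k (t k)) * Lambda K (piCharFun μ ∘ chi K) t := by
  simp only [cumulantPoly, Lambda, Function.comp, Finset.mul_sum, mul_left_comm _ (mu _)]
  rw [integral_finsetSum _ fun α _ => (integrable_partition_term μ hw α).const_mul (mu α)]
  refine Finset.sum_congr rfl fun α _ => ?_
  rw [integral_const_mul, integral_partition_term μ hw hg]

lemma integrable_prod_mul_Lambda (hw : ∀ k, Integrable (w k)) (K : Finset ι) :
    Integrable fun t : K → ℝ => (∏ k : K, w k (t k)) * Lambda K (piCharFun μ ∘ chi K) t := by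
  simp only [Lambda, Function.comp, Finset.mul_sum, mul_left_comm _ (mu _)]
  exact integrable_finsetSum _ fun α _ => (integrable_partition_term μ hw α).const_mul (mu α)

/-- Bound for differences of cumulant polynomials when the weights decay like `1 / |t|`. -/
theorem enorm_cumulantPoly_sub_le (ν : Measure (ι → ℝ)) [IsProbabilityMeasure ν]
    (hw : ∀ k, Integrable (w k))
    (hg : ∀ k x, g k x = ∫ t : ℝ, w k t * Complex.exp (t * x * Complex.I)) {c T : ℝ}
    (hc : ∀ k t, ‖w k t‖ ≤ c / |t|) (hT : ∀ k t, T ≤ |t| → w k t = 0)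
    {K : Finset ι} (hK : K.Nonempty) :
    ‖cumulantPoly K (fun J => ∫ x, ∏ k ∈ J, g k (x k) ∂μ) -
      cumulantPoly K (fun J => ∫ x, ∏ k ∈ J, g k (x k) ∂ν)‖ₑ ≤
      ENNReal.ofReal (c ^ K.card) * lambdaIntegral (piCharFun μ) (piCharFun ν) K T := by
  rw [cumulantPoly_eq_integral μ hw hg, cumulantPoly_eq_integral ν hw hg,
    ← integral_sub (integrable_prod_mul_Lambda μ hw K) (integrable_prod_mul_Lambda ν hw K),
    lambdaIntegral, ← lintegral_indicator (isClosed_le continuous_norm continuous_const).measurableSet,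
    ← lintegral_const_mul' _ _ ENNReal.ofReal_ne_top]
  refine (enorm_integral_le_lintegral_enorm _).trans (lintegral_mono fun t => ?_)
  simp only
  rw [← mul_sub]
  by_cases ht : t ∈ {t : K → ℝ | ‖t‖ ≤ T}
  · rw [Set.indicator_of_mem ht, ← ofReal_norm, ← ofReal_norm,
      ← ENNReal.ofReal_mul']
    · refine ENNReal.ofReal_le_ofReal ?_
      rw [norm_mul, norm_div, norm_prod, norm_prod, mul_div_assoc', mul_comm, mul_comm (c ^ _),
        mul_div_assoc]
      refine mul_le_mul_of_nonneg_left ?_ (norm_nonneg _)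
      -- At `t k = 0` division by zero gives `c / |t k| = 0`, so `hc` forces the weight to vanish
      -- there; this agrees with the value `0` of the quotient in `lambdaIntegral`.
      refine (Finset.prod_le_prod (fun _ _ => norm_nonneg _) fun (k : K) _ => hc k (t k)).trans_eq ?_
      rw [Finset.prod_div_distrib, Finset.prod_const]
      simp
    · exact norm_nonneg _
  · have : ∃ k : K, T ≤ |t k| := by
      by_contra! h
      have : Nonempty K := hK.to_subtype
      exact ht ((pi_norm_le_iff_of_nonempty _).2 fun k => (h k).le)
    obtain ⟨k, hk⟩ := this
    rw [Finset.prod_eq_zero (Finset.mem_univ k) (hT k _ hk)]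
    simp

end Cumulants

/-! ### Comparison of the smoothed distribution functions. -/

section Smoothing

variable {ι : Type*} [Fintype ι]

/-- The distribution of a random vector with independent Fejér distributed coordinates. -/
noncomputable def fejerPi (ι : Type*) [Fintype ι] : Measure (ι → ℝ) :=
  Measure.pi fun _ => fejerMeasure

instance isProbabilityMeasure_fejerPi : IsProbabilityMeasure (fejerPi ι) := by
  unfold fejerPi; infer_instance

/-- The probability that a `μ`-distributed vector smoothed with `fejerPi / T` lies in `(a, b]`. -/
noncomputable def smoothBox (μ : Measure (ι → ℝ)) (T : ℝ) (a b : ι → ℝ) : ℝ :=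
  (μ.prod (fejerPi ι)).real {p | ∀ k, a k < p.1 k + p.2 k / T ∧ p.1 k + p.2 k / T ≤ b k}

/-- The distribution function of a `μ`-distributed vector smoothed with `fejerPi / T`. -/
noncomputable def smoothCdf (μ : Measure (ι → ℝ)) (T : ℝ) (b : ι → ℝ) : ℝ :=
  (μ.prod (fejerPi ι)).real {p | ∀ k, p.1 k + p.2 k / T ≤ b k}

lemma measurableSet_smoothBox (T : ℝ) (a b : ι → ℝ) :
    MeasurableSet {p : (ι → ℝ) × (ι → ℝ) |
      ∀ k, a k < p.1 k + p.2 k / T ∧ p.1 k + p.2 k / T ≤ b k} := by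
  have hm : ∀ k, Measurable fun p : (ι → ℝ) × (ι → ℝ) => p.1 k + p.2 k / T := by
    intro k; fun_prop
  have : {p : (ι → ℝ) × (ι → ℝ) | ∀ k, a k < p.1 k + p.2 k / T ∧ p.1 k + p.2 k / T ≤ b k} =
      ⋂ k, (fun p : (ι → ℝ) × (ι → ℝ) => p.1 k + p.2 k / T) ⁻¹' Set.Ioc (a k) (b k) := by
    ext p; simp
  rw [this]
  exact MeasurableSet.iInter fun k => hm k measurableSet_Ioc

lemma measurableSet_smoothCdf (T : ℝ) (b : ι → ℝ) :
    MeasurableSet {p : (ι → ℝ) × (ι → ℝ) | ∀ k, p.1 k + p.2 k / T ≤ b k} := by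
  have hm : ∀ k, Measurable fun p : (ι → ℝ) × (ι → ℝ) => p.1 k + p.2 k / T := by
    intro k; fun_prop
  have : {p : (ι → ℝ) × (ι → ℝ) | ∀ k, p.1 k + p.2 k / T ≤ b k} =
      ⋂ k, (fun p : (ι → ℝ) × (ι → ℝ) => p.1 k + p.2 k / T) ⁻¹' Set.Iic (b k) := by
    ext p; simp
  rw [this]
  exact MeasurableSet.iInter fun k => hm k measurableSet_Iic

lemma prod_real_apply {E E' : Type*} [MeasurableSpace E] [MeasurableSpace E'] (μ : Measure E)
    (ν : Measure E') [IsFiniteMeasure μ] [IsFiniteMeasure ν] {s : Set (E × E')}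
    (hs : MeasurableSet s) : (μ.prod ν).real s = ∫ x, ν.real (Prod.mk x ⁻¹' s) ∂μ := by
  rw [measureReal_def, Measure.prod_apply hs]
  exact (integral_toReal (measurable_measure_prodMk_left hs).aemeasurable
    (Filter.Eventually.of_forall fun _ => measure_lt_top _ _)).symm

lemma prod_real_apply_symm {E E' : Type*} [MeasurableSpace E] [MeasurableSpace E'] (μ : Measure E)
    (ν : Measure E') [IsFiniteMeasure μ] [IsFiniteMeasure ν] {s : Set (E × E')}
    (hs : MeasurableSet s) : (μ.prod ν).real s = ∫ y, μ.real ((fun x => (x, y)) ⁻¹' s) ∂ν := by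
  rw [measureReal_def, Measure.prod_apply_symm hs]
  exact (integral_toReal (measurable_measure_prodMk_right hs).aemeasurable
    (Filter.Eventually.of_forall fun _ => measure_lt_top _ _)).symm

lemma smoothBox_eq_integral (μ : Measure (ι → ℝ)) [IsProbabilityMeasure μ] (T : ℝ)
    (a b : ι → ℝ) :
    smoothBox μ T a b = ∫ x, ∏ k, fejerMeasure.real
      {u | a k < x k + u / T ∧ x k + u / T ≤ b k} ∂μ := by
  rw [smoothBox, prod_real_apply _ _ (measurableSet_smoothBox T a b)]
  refine integral_congr_ae (Filter.Eventually.of_forall fun x => ?_)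
  simp only [measureReal_def]
  rw [← ENNReal.toReal_prod, fejerPi, ← Measure.pi_pi]
  congr 2
  ext u
  simp

lemma preimage_smoothCdf {κ : Type*} (T : ℝ) (b u : κ → ℝ) :
    (fun x => (x, u)) ⁻¹' {p : (κ → ℝ) × (κ → ℝ) | ∀ k, p.1 k + p.2 k / T ≤ b k} =
      Set.Iic (b - T⁻¹ • u) := by
  ext x
  simp [Pi.le_def, le_sub_iff_add_le, div_eq_inv_mul]

/-- Conditioning on the noise instead of the vector shows the smoothed distribution function as an
average of translates, the form needed for removing the smoothing. -/
lemma smoothCdf_eq_integral (μ : Measure (ι → ℝ)) [IsProbabilityMeasure μ] (T : ℝ)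
    (b : ι → ℝ) :
    smoothCdf μ T b = ∫ u, μ.real (Set.Iic (b - T⁻¹ • u)) ∂(fejerPi ι) := by
  rw [smoothCdf, prod_real_apply_symm _ _ (measurableSet_smoothCdf T b)]
  simp_rw [preimage_smoothCdf]

lemma integrable_measureReal_Iic (μ : Measure (ι → ℝ)) [IsProbabilityMeasure μ] (T : ℝ)
    (b : ι → ℝ) :
    Integrable (fun u => μ.real (Set.Iic (b - T⁻¹ • u))) (fejerPi ι) := by
  have hm : Measurable fun u => μ (Set.Iic (b - T⁻¹ • u)) := by
    simp_rw [← preimage_smoothCdf]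
    exact measurable_measure_prodMk_right (measurableSet_smoothCdf T b)
  refine (integrable_const (1 : ℝ)).mono' hm.ennreal_toReal.aestronglyMeasurable
    (Filter.Eventually.of_forall fun u => ?_)
  rw [Real.norm_of_nonneg measureReal_nonneg]
  exact measureReal_le_one

lemma tendsto_smoothBox (μ : Measure (ι → ℝ)) [IsProbabilityMeasure μ] (T : ℝ) (b : ι → ℝ) :
    Filter.Tendsto (fun n : ℕ => smoothBox μ T (fun k => b k - n) b) Filter.atTop
      (nhds (smoothCdf μ T b)) := by
  have hU : {p : (ι → ℝ) × (ι → ℝ) | ∀ k, p.1 k + p.2 k / T ≤ b k} = ⋃ n : ℕ,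
      {p | ∀ k, b k - n < p.1 k + p.2 k / T ∧ p.1 k + p.2 k / T ≤ b k} := by
    ext p
    simp only [Set.mem_ofPred_eq, Set.mem_iUnion]
    refine ⟨fun h => ?_, fun ⟨n, hn⟩ k => (hn k).2⟩
    obtain ⟨n, hn⟩ := exists_nat_gt (∑ k, |b k - (p.1 k + p.2 k / T)|)
    refine ⟨n, fun k => ⟨?_, h k⟩⟩
    have h1 : |b k - (p.1 k + p.2 k / T)| ≤ ∑ k, |b k - (p.1 k + p.2 k / T)| :=
      Finset.single_le_sum (f := fun k => |b k - (p.1 k + p.2 k / T)|)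
        (fun _ _ => abs_nonneg _) (Finset.mem_univ k)
    linarith [le_abs_self (b k - (p.1 k + p.2 k / T))]
  unfold smoothBox smoothCdf
  rw [hU]
  refine (ENNReal.tendsto_toReal (measure_ne_top _ _)).comp
    (tendsto_measure_iUnion_atTop fun n n' hn p hp k => ⟨?_, (hp k).2⟩)
  have : (n : ℝ) ≤ n' := Nat.cast_le.2 hn
  linarith [(hp k).1]

variable [DecidableEq ι]

/-- The box probability is the moment of the full index set for the variables `g k (x k)`, so it is
controlled by the cumulants of all nonempty subsets. Nonemptiness of `ι` makes the full set one of
these. -/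
lemma exists_smoothBox_le (ι : Type*) [Fintype ι] [DecidableEq ι] [Nonempty ι] : ∃ C : ℝ, 0 ≤ C ∧
    ∀ (μ ν : Measure (ι → ℝ)) [IsProbabilityMeasure μ] [IsProbabilityMeasure ν] (T : ℝ), 0 < T →
      ∀ a b : ι → ℝ, a ≤ b → ENNReal.ofReal |smoothBox μ T a b - smoothBox ν T a b| ≤
        ENNReal.ofReal C * ∑ K : Finset ι with K.Nonempty,
          lambdaIntegral (piCharFun μ) (piCharFun ν) K T := by
  obtain ⟨C, hC, h⟩ := exists_sub_le_cumulantPoly (ι := ι)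
  have hc0 : 0 ≤ (∫ v, fejer v)⁻¹ * 2 := mul_nonneg (inv_nonneg.2 integral_fejer_pos.le) zero_le_two
  set c := (∫ v, fejer v)⁻¹ * 2 with hc
  -- `(1 + c) ^ Fintype.card ι` dominates `c ^ K.card` for every `K`, whether or not `c ≥ 1`.
  refine ⟨C * (1 + c) ^ Fintype.card ι, by positivity, fun μ ν _ _ T hT a b hab => ?_⟩
  set g : ι → ℝ → ℂ := fun k x =>
    (fejerMeasure.real {u | a k < x + u / T ∧ x + u / T ≤ b k} : ℂ) with hgdef
  have hg : ∀ k x, g k x = ∫ t : ℝ, fejerWeight T (a k) (b k) t * Complex.exp (t * x * Complex.I) :=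
    fun k x => fejerMeasure_real_eq_integral hT (hab k) x
  have hg1 : ∀ k x, ‖g k x‖ ≤ 1 := by
    intro k x
    rw [hgdef, Complex.norm_real, Real.norm_of_nonneg measureReal_nonneg]
    exact measureReal_le_one
  have hA : ∀ (ξ : Measure (ι → ℝ)) [IsProbabilityMeasure ξ] (J : Finset ι),
      ‖∫ x, ∏ k ∈ J, g k (x k) ∂ξ‖ ≤ 1 := by
    intro ξ _ J
    refine (norm_integral_le_of_norm_le_const (C := 1)
      (Filter.Eventually.of_forall fun x => ?_)).trans (by simp)
    rw [norm_prod]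
    exact Finset.prod_le_one (fun _ _ => norm_nonneg _) fun k _ => hg1 k _
  have hbox : ∀ (ξ : Measure (ι → ℝ)) [IsProbabilityMeasure ξ],
      (smoothBox ξ T a b : ℂ) = ∫ x, ∏ k, g k (x k) ∂ξ := by
    intro ξ _
    rw [smoothBox_eq_integral, ← integral_complex_ofReal]
    refine integral_congr_ae (Filter.Eventually.of_forall fun x => ?_)
    simp [hgdef]
  have hmain := h (fun J => ∫ x, ∏ k ∈ J, g k (x k) ∂μ) (fun J => ∫ x, ∏ k ∈ J, g k (x k) ∂ν)
    (hA μ) (hA ν) Finset.univ Finset.univ_nonempty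
  rw [← hbox μ, ← hbox ν, ← Complex.ofReal_sub, Complex.norm_real, Real.norm_eq_abs] at hmain
  refine (ENNReal.ofReal_le_ofReal hmain).trans ?_
  rw [ENNReal.ofReal_mul hC, ENNReal.ofReal_mul hC, mul_assoc,
    ENNReal.ofReal_sum_of_nonneg fun _ _ => norm_nonneg _]
  refine mul_le_mul_right ?_ _
  rw [Finset.mul_sum]
  refine Finset.sum_le_sum fun K hK => ?_
  rw [ofReal_norm]
  refine (enorm_cumulantPoly_sub_le μ ν
    (fun k => integrable_fejerWeight hT (a k) (b k)) hg (c := c) (T := T)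
    (fun k t => norm_fejerWeight_le T (a k) (b k) t)
    (fun k t ht => fejerWeight_eq_zero hT ht) (Finset.mem_filter.1 hK).2).trans ?_
  refine mul_le_mul_left (ENNReal.ofReal_le_ofReal ?_) _
  calc c ^ K.card ≤ (1 + c) ^ K.card := by gcongr; linarith
    _ ≤ (1 + c) ^ Fintype.card ι := pow_le_pow_right₀ (by linarith) (Finset.card_le_univ K)

lemma exists_smoothCdf_le (ι : Type*) [Fintype ι] [DecidableEq ι] [Nonempty ι] : ∃ C : ℝ, 0 ≤ C ∧
    ∀ (μ ν : Measure (ι → ℝ)) [IsProbabilityMeasure μ] [IsProbabilityMeasure ν] (T : ℝ), 0 < T →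
      ∀ b : ι → ℝ, ENNReal.ofReal |smoothCdf μ T b - smoothCdf ν T b| ≤
        ENNReal.ofReal C * ∑ K : Finset ι with K.Nonempty,
          lambdaIntegral (piCharFun μ) (piCharFun ν) K T := by
  obtain ⟨C, hC, h⟩ := exists_smoothBox_le ι
  refine ⟨C, hC, fun μ ν _ _ T hT b => ?_⟩
  refine le_of_tendsto (ENNReal.tendsto_ofReal
    ((tendsto_smoothBox μ T b).sub (tendsto_smoothBox ν T b)).abs)
    (Filter.Eventually.of_forall fun n => h μ ν T hT _ _ fun k => ?_)
  have : (0 : ℝ) ≤ n := Nat.cast_nonneg n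
  simp

end Smoothing

/-! ### Removing the smoothing. -/

section Unsmoothing

variable {ι : Type*} [Fintype ι]

/-- The Fejér law has no first moment, so only its concentration on a ball is used. Any mass above
`1/2` would allow the later absorption; `3/4` is a convenient choice. -/
lemma exists_fejerPi_closedBall (ι : Type*) [Fintype ι] : ∃ r : ℝ, 0 ≤ r ∧
    3 / 4 ≤ (fejerPi ι).real {u | ‖u‖ ≤ r} := by
  have hU : (Set.univ : Set (ι → ℝ)) = ⋃ n : ℕ, {u | ‖u‖ ≤ n} := by
    ext u
    simpa using exists_nat_ge ‖u‖
  have ht : Filter.Tendsto (fun n : ℕ => (fejerPi ι).real {u | ‖u‖ ≤ n}) Filter.atTop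
      (nhds 1) := by
    have h1 : (fejerPi ι).real Set.univ = 1 := probReal_univ
    rw [← h1, hU]
    exact (ENNReal.tendsto_toReal (measure_ne_top _ _)).comp
      (tendsto_measure_iUnion_atTop fun n n' hn u (hu : ‖u‖ ≤ n) =>
        hu.trans (Nat.cast_le.2 hn))
  obtain ⟨n, hn⟩ := (ht.eventually (le_mem_nhds (by norm_num : (3 / 4 : ℝ) < 1))).exists
  exact ⟨n, Nat.cast_nonneg n, hn⟩

lemma le_of_integral_le {E : Type*} [MeasurableSpace E] {ρ : Measure E} [IsProbabilityMeasure ρ]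
    {s : Set E} (hs : MeasurableSet s) (hρ : 3 / 4 ≤ ρ.real s) {f : E → ℝ} (hf : Integrable f ρ)
    {d δ B : ℝ} (hd : ∀ u ∈ s, d ≤ f u) (hδ : ∀ u, -δ ≤ f u) (hB : ∫ u, f u ∂ρ ≤ B)
    (hB0 : 0 ≤ B) (hδ0 : 0 ≤ δ) : 3 * d ≤ 4 * B + δ := by
  -- For `d ≤ 0` the claim is trivial; for `d > 0` the masses of `s` and its complement may be
  -- replaced by `3/4` and `1/4`.
  rcases le_or_gt d 0 with h0 | h0
  · linarith
  have h1 : ρ.real s * d ≤ ∫ u in s, f u ∂ρ := by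
    rw [← smul_eq_mul, ← setIntegral_const]
    exact setIntegral_mono_on integrableOn_const hf.integrableOn hs hd
  have h2 : ρ.real sᶜ * (-δ) ≤ ∫ u in sᶜ, f u ∂ρ := by
    rw [← smul_eq_mul, ← setIntegral_const]
    exact setIntegral_mono_on integrableOn_const hf.integrableOn hs.compl fun u _ => hδ u
  have h3 := integral_add_compl hs hf
  have h4 : ρ.real sᶜ = 1 - ρ.real s := probReal_compl_eq_one_sub hs
  rw [h4] at h2
  nlinarith [mul_nonneg (sub_nonneg.2 hρ) h0.le, mul_nonneg (sub_nonneg.2 hρ) hδ0]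

/-- A bound for the smoothed difference of two distribution functions, the second of which is
Lipschitz, implies a bound for their difference. -/
lemma abs_cdf_sub_le {r T B A : ℝ} (hT : 0 < T)
    (hρ : 3 / 4 ≤ (fejerPi ι).real {u | ‖u‖ ≤ r})
    (μ ν : Measure (ι → ℝ)) [IsProbabilityMeasure μ] [IsProbabilityMeasure ν]
    (hB : ∀ b, |smoothCdf μ T b - smoothCdf ν T b| ≤ B)
    (hA : ∀ z v : ι → ℝ, 0 ≤ v → (∀ k, v k ≤ 2 * (r / T)) →
      ν.real (Set.Iic (z + v)) ≤ ν.real (Set.Iic z) + 2 * (r / T) * A) (z : ι → ℝ) :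
    |μ.real (Set.Iic z) - ν.real (Set.Iic z)| ≤ 3 * (r / T) * A + 2 * B := by
  set D : (ι → ℝ) → ℝ := fun z => μ.real (Set.Iic z) - ν.real (Set.Iic z) with hD
  have hD1 : ∀ z, |D z| ≤ 1 := by
    intro z
    rw [abs_le]
    have h1 : μ.real (Set.Iic z) ≤ 1 := measureReal_le_one
    have h2 : ν.real (Set.Iic z) ≤ 1 := measureReal_le_one
    have h3 : 0 ≤ μ.real (Set.Iic z) := measureReal_nonneg
    have h4 : 0 ≤ ν.real (Set.Iic z) := measureReal_nonneg
    constructor <;> simp only [hD] <;> linarith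
  have hbdd : BddAbove (Set.range fun z => |D z|) := ⟨1, by rintro _ ⟨z, rfl⟩; exact hD1 z⟩
  set δ := ⨆ z, |D z| with hδ
  have hδz : ∀ z, |D z| ≤ δ := fun z => le_ciSup hbdd z
  have hδ0 : 0 ≤ δ := (abs_nonneg _).trans (hδz 0)
  have hB0 : 0 ≤ B := (abs_nonneg _).trans (hB 0)
  have hms : MeasurableSet {u : ι → ℝ | ‖u‖ ≤ r} :=
    (isClosed_le continuous_norm continuous_const).measurableSet
  have hint : ∀ b, Integrable (fun u => D (b - T⁻¹ • u)) (fejerPi ι) := fun b =>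
    (integrable_measureReal_Iic μ T b).sub (integrable_measureReal_Iic ν T b)
  have hBint : ∀ b, |∫ u, D (b - T⁻¹ • u) ∂(fejerPi ι)| ≤ B := by
    intro b
    have := hB b
    rwa [smoothCdf_eq_integral, smoothCdf_eq_integral,
      ← integral_sub (integrable_measureReal_Iic μ T b) (integrable_measureReal_Iic ν T b)] at this
  have hu : ∀ u ∈ {u : ι → ℝ | ‖u‖ ≤ r}, ∀ k, |(T⁻¹ • u) k| ≤ r / T := by
    intro u hu k
    rw [Pi.smul_apply, smul_eq_mul, abs_mul, abs_of_pos (inv_pos.2 hT), ← div_eq_inv_mul]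
    exact div_le_div_of_nonneg_right ((norm_le_pi_norm u k).trans hu) hT.le
  have hmono : ∀ (ξ : Measure (ι → ℝ)) [IsProbabilityMeasure ξ] (x v : ι → ℝ), 0 ≤ v →
      ξ.real (Set.Iic x) ≤ ξ.real (Set.Iic (x + v)) := fun ξ _ x v hv =>
    measureReal_mono (Set.Iic_subset_Iic.2 (le_add_of_nonneg_right hv))
  -- Shifting the centre up by `r / T` makes each argument `z + r / T - u / T` with `‖u‖ ≤ r` lie
  -- above `z`, by at most `2 r / T` per coordinate. There the first distribution function is at
  -- least its value at `z`, and the second has grown by at most `2 (r / T) A`. The bound for `-D`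
  -- shifts down instead.
  have hup : ∀ z, 3 * (D z - 2 * (r / T) * A) ≤ 4 * B + δ := by
    intro z
    refine le_of_integral_le hms hρ (hint (z + fun _ => r / T)) (fun u hus => ?_)
      (fun u => (abs_le.1 (hδz _)).1) (abs_le.1 (hBint _)).2 hB0 hδ0
    have hv0 : 0 ≤ (fun _ => r / T) - T⁻¹ • u := fun k =>
      sub_nonneg.2 (abs_le.1 (hu u hus k)).2
    have hv1 : ∀ k, ((fun _ => r / T) - T⁻¹ • u : ι → ℝ) k ≤ 2 * (r / T) := fun k => by
      have := (abs_le.1 (hu u hus k)).1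
      rw [Pi.sub_apply]
      linarith
    have h1 := hA z _ hv0 hv1
    have h2 := hmono μ z _ hv0
    rw [add_sub_assoc]
    simp only [hD]
    linarith
  have hlow : ∀ z, 3 * (-D z - 2 * (r / T) * A) ≤ 4 * B + δ := by
    intro z
    refine le_of_integral_le hms hρ (hint (z - fun _ => r / T)).neg (fun u hus => ?_)
      (fun u => neg_le_neg (abs_le.1 (hδz _)).2) ?_ hB0 hδ0
    · have hv0 : 0 ≤ (fun _ => r / T) + T⁻¹ • u := fun k => by
        have := (abs_le.1 (hu u hus k)).1
        rw [Pi.add_apply, Pi.zero_apply]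
        linarith
      have hv1 : ∀ k, ((fun _ => r / T) + T⁻¹ • u : ι → ℝ) k ≤ 2 * (r / T) := fun k => by
        have := (abs_le.1 (hu u hus k)).2
        rw [Pi.add_apply]
        linarith
      have h1 := hA ((z - fun _ => r / T) - T⁻¹ • u) _ hv0 hv1
      have h2 := hmono μ ((z - fun _ => r / T) - T⁻¹ • u) _ hv0
      have h3 : (z - fun _ => r / T) - T⁻¹ • u + ((fun _ => r / T) + T⁻¹ • u) = z := by
        ext k; simp
      rw [h3] at h1 h2
      simp only [Pi.neg_apply, hD]
      linarith
    · simp only [Pi.neg_apply, integral_neg]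
      linarith [(abs_le.1 (hBint (z - fun _ => r / T))).1]
  have hle : ∀ z, |D z| ≤ 2 * (r / T) * A + (4 * B + δ) / 3 := by
    intro z
    rw [abs_le]
    constructor <;> linarith [hup z, hlow z]
  -- Since `δ` is finite, `δ / 3` can be moved to the left, giving `δ ≤ 3 (r / T) A + 2 B`.
  have hδle : δ ≤ 2 * (r / T) * A + (4 * B + δ) / 3 := ciSup_le hle
  linarith [hδz z]

/-- A differentiable function with partial derivatives bounded above is Lipschitz from above on
the positive cone. -/
lemma le_add_sum_of_fderiv_le [DecidableEq ι] {G : (ι → ℝ) → ℝ} (hG : Differentiable ℝ G)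
    {A : ι → ℝ} (hA : ∀ y j, fderiv ℝ G y (Pi.single j 1) ≤ A j) (z v : ι → ℝ) (hv : 0 ≤ v) :
    G (z + v) ≤ G z + ∑ j, A j * v j := by
  have hd : ∀ s : ℝ, HasDerivAt (fun s : ℝ => G (z + s • v)) (fderiv ℝ G (z + s • v) v) s := by
    intro s
    have h1 : HasDerivAt (fun s : ℝ => z + s • v) v s := by
      simpa using ((hasDerivAt_id s).smul_const v).const_add z
    exact (hG _).hasFDerivAt.comp_hasDerivAt s h1
  have hle : ∀ y, fderiv ℝ G y v ≤ ∑ j, A j * v j := by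
    intro y
    conv_lhs => rw [← Finset.univ_sum_single v, map_sum]
    refine Finset.sum_le_sum fun j _ => ?_
    have : (Pi.single j (v j) : ι → ℝ) = v j • Pi.single j 1 := by
      rw [← Pi.single_smul, smul_eq_mul, mul_one]
    rw [this, map_smul, smul_eq_mul, mul_comm]
    exact mul_le_mul_of_nonneg_right (hA y j) (hv j)
  have hdiff : Differentiable ℝ (fun s : ℝ => G (z + s • v)) := fun s => (hd s).differentiableAt
  have := image_sub_le_mul_sub_of_deriv_le hdiff
    (C := ∑ j, A j * v j) (fun s => by rw [(hd s).deriv]; exact hle _) zero_le_one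
  simp only [one_smul, zero_smul, add_zero, sub_zero, mul_one] at this
  linarith

end Unsmoothing

/-! ### Zeroing coordinates of the frequency vector. -/

section Projections

variable {ι : Type*} [DecidableEq ι]

lemma chi_psi_erase (K J : Finset ι) (k : ι) (t : K → ℝ) :
    chi K (psi (J.erase k) K t) = Function.update (chi K (psi J K t)) k 0 := by
  ext l
  by_cases hl : l = k
  · subst hl
    simp [chi, psi]
  · simp [chi, psi, hl]

lemma chi_psi_empty (K : Finset ι) (t : K → ℝ) : chi K (psi ∅ K t) = 0 := by
  ext l
  simp [chi, psi]

lemma abs_chi_psi_le (K J : Finset ι) (k : K) (t : K → ℝ) :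
    |chi K (psi J K t) k| ≤ |t k| := by
  simp only [chi, psi, Finset.coe_mem, dite_true]
  split_ifs <;> simp

end Projections

/-! ### Finiteness of the integrals under first moments. -/

section Finiteness

variable {ι : Type*} [Fintype ι]

lemma norm_piCharFun_le (μ : Measure (ι → ℝ)) [IsProbabilityMeasure μ] (t : ι → ℝ) :
    ‖piCharFun μ t‖ ≤ 1 := by
  refine (norm_integral_le_of_norm_le_const (C := 1)
    (Filter.Eventually.of_forall fun x => ?_)).trans (by simp)
  rw [norm_prod]
  exact Finset.prod_le_one (fun _ _ => norm_nonneg _) fun k _ => (norm_exp_mul_I _ _).le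

lemma piCharFun_zero (μ : Measure (ι → ℝ)) [IsProbabilityMeasure μ] : piCharFun μ 0 = 1 := by
  simp [piCharFun]

lemma integrable_prod_exp (μ : Measure (ι → ℝ)) [IsProbabilityMeasure μ] (t : ι → ℝ) :
    Integrable (fun x : ι → ℝ => ∏ j, Complex.exp (t j * x j * Complex.I)) μ := by
  refine (integrable_const (1 : ℝ)).mono' (Continuous.aestronglyMeasurable (by fun_prop))
    (Filter.Eventually.of_forall fun x => ?_)
  rw [norm_prod]
  exact Finset.prod_le_one (fun _ _ => norm_nonneg _) fun k _ => (norm_exp_mul_I _ _).le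

/-- The two integrands differ by the factor `exp(i t_k x_k) - 1` times numbers of modulus one, and
`|exp(i u) - 1| ≤ |u|`. -/
lemma norm_piCharFun_sub_update_le [DecidableEq ι] (μ : Measure (ι → ℝ)) [IsProbabilityMeasure μ]
    (hμ : Integrable (fun x : ι → ℝ => x) μ) (t : ι → ℝ) (k : ι) :
    ‖piCharFun μ t - piCharFun μ (Function.update t k 0)‖ ≤ |t k| * ∫ x, |x k| ∂μ := by
  rw [piCharFun, piCharFun, ← integral_sub (integrable_prod_exp μ _) (integrable_prod_exp μ _),
    ← integral_const_mul]
  have hk : Integrable (fun x : ι → ℝ => |x k|) μ := (hμ.eval k).abs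
  refine norm_integral_le_of_norm_le (hk.const_mul _) (Filter.Eventually.of_forall fun x => ?_)
  have hupd : ∏ j, Complex.exp (Function.update t k 0 j * x j * Complex.I) =
      ∏ j ∈ Finset.univ.erase k, Complex.exp (t j * x j * Complex.I) := by
    rw [← Finset.mul_prod_erase _ _ (Finset.mem_univ k)]
    simp only [Function.update_self, Complex.ofReal_zero, zero_mul, Complex.exp_zero, one_mul]
    exact Finset.prod_congr rfl fun j hj => by
      rw [Function.update_of_ne (Finset.ne_of_mem_erase hj)]
  rw [hupd, ← Finset.mul_prod_erase _ _ (Finset.mem_univ k), ← sub_one_mul, norm_mul, norm_prod,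
    Finset.prod_congr rfl fun j _ => norm_exp_mul_I (t j) (x j), Finset.prod_const_one, mul_one,
    ← abs_mul, ← Complex.ofReal_mul, mul_comm _ Complex.I]
  exact Real.norm_exp_I_mul_ofReal_sub_one_le

variable [DecidableEq ι]

/-- Under a first moment condition `Λ_K` of the characteristic function is linearly small in every
variable, up to a universal value. -/
lemma exists_norm_Lambda_sub_le (μ ν : Measure (ι → ℝ)) [IsProbabilityMeasure μ]
    [IsProbabilityMeasure ν] (hμ : Integrable (fun x : ι → ℝ => x) μ)
    (hν : Integrable (fun x : ι → ℝ => x) ν) (K : Finset ι) :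
    ∃ D : ℝ, 0 ≤ D ∧ ∀ (t : K → ℝ) (k : K),
      ‖Lambda K (piCharFun μ ∘ chi K) t - Lambda K (piCharFun ν ∘ chi K) t‖ ≤ D * |t k| := by
  obtain ⟨C, hC, h⟩ := norm_cumulantPoly_sub_le K
  have hM : ∀ ξ : Measure (ι → ℝ), 0 ≤ ∑ k, ∫ x : ι → ℝ, |x k| ∂ξ := fun ξ =>
    Finset.sum_nonneg fun k _ => integral_nonneg fun x => abs_nonneg _
  refine ⟨C * ∑ k, ∫ x : ι → ℝ, |x k| ∂μ + C * ∑ k, ∫ x : ι → ℝ, |x k| ∂ν,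
    add_nonneg (mul_nonneg hC (hM μ)) (mul_nonneg hC (hM ν)), fun t k => ?_⟩
  set a : Measure (ι → ℝ) → Finset ι → ℂ := fun ξ J => piCharFun ξ (chi K (psi J K t)) with ha
  have hone : ∀ (ξ : Measure (ι → ℝ)) [IsProbabilityMeasure ξ],
      Integrable (fun x : ι → ℝ => x) ξ →
      ‖cumulantPoly K (a ξ) - cumulantPoly K (fun J => a ξ (J.erase k))‖ ≤
        C * (∑ k, ∫ x : ι → ℝ, |x k| ∂ξ) * |t k| := by
    intro ξ _ hξ
    rw [mul_assoc]
    refine h _ _ _ (fun J => norm_piCharFun_le ξ _) (fun J => norm_piCharFun_le ξ _) fun J => ?_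
    simp only [ha]
    rw [chi_psi_erase, mul_comm]
    refine (norm_piCharFun_sub_update_le ξ hξ _ _).trans ?_
    refine mul_le_mul (abs_chi_psi_le K J k t) ?_ (integral_nonneg fun x => abs_nonneg _)
      (abs_nonneg _)
    exact Finset.single_le_sum (f := fun k => ∫ x : ι → ℝ, |x k| ∂ξ)
      (fun k _ => integral_nonneg fun x => abs_nonneg _) (Finset.mem_univ (k : ι))
  have hempty : ∀ (ξ : Measure (ι → ℝ)) [IsProbabilityMeasure ξ], a ξ ∅ = 1 := by
    intro ξ _
    simp only [ha]
    rw [chi_psi_empty, piCharFun_zero]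
  -- The value left after setting `t k = 0` is the same for both measures: if `K = {k}` only `a ∅ =
  -- 1` occurs, and otherwise a cumulant with a constant entry vanishes.
  have heq : cumulantPoly K (fun J => a μ (J.erase k)) =
      cumulantPoly K (fun J => a ν (J.erase k)) := by
    by_cases hK : K = {(k : ι)}
    · refine Finset.sum_congr rfl fun α _ => ?_
      congr 1
      refine Finset.prod_congr rfl fun J hJ => ?_
      have : J.erase k = ∅ := by
        have hJK := α.subset hJ
        rw [hK] at hJK
        rw [Finset.erase_eq_empty_iff]
        exact Finset.subset_singleton_iff.1 hJK
      simp only [this, hempty]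
    · rw [cumulantPoly_eq_zero k.2 hK _ (by simp [hempty]) (by simp),
        cumulantPoly_eq_zero k.2 hK _ (by simp [hempty]) (by simp)]
  rw [Lambda_eq_cumulantPoly, Lambda_eq_cumulantPoly]
  calc ‖cumulantPoly K (a μ) - cumulantPoly K (a ν)‖
      = ‖(cumulantPoly K (a μ) - cumulantPoly K (fun J => a μ (J.erase k))) -
          (cumulantPoly K (a ν) - cumulantPoly K (fun J => a ν (J.erase k)))‖ := by
        rw [heq]; congr 1; ring
    _ ≤ _ := (norm_sub_le _ _).trans (add_le_add (hone μ hμ) (hone ν hν))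
    _ = _ := by ring

lemma integrableOn_abs_rpow {r : ℝ} (hr : -1 < r) (T : ℝ) :
    IntegrableOn (fun s : ℝ => |s| ^ r) (Set.Icc (-T) T) := by
  rcases lt_or_ge T 0 with hT | hT
  · rw [Set.Icc_eq_empty (by linarith)]
    exact integrableOn_empty
  have h1 : IntervalIntegrable (fun s : ℝ => |s| ^ r) volume 0 T := by
    refine (intervalIntegral.intervalIntegrable_rpow' hr).congr ?_
    intro s hs
    rw [Set.uIoc_of_le hT] at hs
    simp only [abs_of_pos hs.1]
  have h2 : IntervalIntegrable (fun s : ℝ => |s| ^ r) volume (-T) 0 := by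
    have := (h1.comp_sub_left 0).symm
    simpa using this
  rw [← intervalIntegrable_iff_integrableOn_Icc_of_le (by linarith)]
  exact h2.trans h1

/-- The linear bound holds in each of the `n = |K|` variables, so its geometric mean bounds the
numerator by `∏ (D |t_k|) ^ (1/n)`. Dividing by `∏ |t_k|` leaves a product of functions `D ^ q |s| ^
(q - 1)` with `q = 1/n > 0`, each integrable on `[-T, T]`. -/
theorem lambdaIntegral_lt_top (μ ν : Measure (ι → ℝ)) [IsProbabilityMeasure μ]
    [IsProbabilityMeasure ν] (hμ : Integrable (fun x : ι → ℝ => x) μ)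
    (hν : Integrable (fun x : ι → ℝ => x) ν) {K : Finset ι} (hK : K.Nonempty) (T : ℝ) :
    lambdaIntegral (piCharFun μ) (piCharFun ν) K T < ∞ := by
  obtain ⟨D, hD, h⟩ := exists_norm_Lambda_sub_le μ ν hμ hν K
  have hn : 0 < (K.card : ℝ) := Nat.cast_pos.2 hK.card_pos
  set q : ℝ := (K.card : ℝ)⁻¹ with hq
  have hq0 : 0 < q := inv_pos.2 hn
  set f : ℝ → ℝ := (Set.Icc (-T) T).indicator fun s => D ^ q * |s| ^ (q - 1) with hf
  have hfi : Integrable f :=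
    IntegrableOn.integrable_indicator
      (Integrable.const_mul (integrableOn_abs_rpow (by linarith) T) _) measurableSet_Icc
  have hprod : Integrable (fun t : K → ℝ => ∏ k, f (t k)) := Integrable.fintype_prod fun _ => hfi
  refine lt_of_le_of_lt ?_ hprod.hasFiniteIntegral
  rw [lambdaIntegral, ← lintegral_indicator
    (isClosed_le continuous_norm continuous_const).measurableSet]
  refine lintegral_mono fun t => ?_
  by_cases ht : t ∈ {t : K → ℝ | ‖t‖ ≤ T}
  swap
  · rw [Set.indicator_of_notMem ht]
    exact zero_le
  rw [Set.indicator_of_mem ht, ← ofReal_norm, ← ofReal_norm]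
  refine ENNReal.ofReal_le_ofReal ?_
  set x := ‖Lambda K (piCharFun μ ∘ chi K) t - Lambda K (piCharFun ν ∘ chi K) t‖ with hx
  have hx0 : 0 ≤ x := norm_nonneg _
  rw [norm_div, norm_prod, norm_prod]
  -- On the coordinate hyperplanes the quotient is `0` by the convention for division by zero.
  by_cases hz : ∃ k, t k = 0
  · obtain ⟨k, hk⟩ := hz
    rw [Finset.prod_eq_zero (Finset.mem_univ k) (by simp [hk]), div_zero]
    positivity
  push Not at hz
  have hxp : x = ∏ _k : K, x ^ q := by
    rw [Finset.prod_const, Finset.card_univ, Fintype.card_coe, ← Real.rpow_natCast,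
      ← Real.rpow_mul hx0, inv_mul_cancel₀ hn.ne', Real.rpow_one]
  rw [← hx, hxp, ← Finset.prod_div_distrib]
  refine Finset.prod_le_prod (fun k _ => by positivity) fun k _ => ?_
  have htk : t k ∈ Set.Icc (-T) T := abs_le.1 ((norm_le_pi_norm t k).trans ht)
  have hpos : 0 < |t k| := abs_pos.2 (hz k)
  rw [hf, Set.indicator_of_mem htk, Complex.norm_real, Real.norm_eq_abs (t k),
    Real.norm_of_nonneg (by positivity), Real.rpow_sub_one hpos.ne', mul_div_assoc',
    ← Real.mul_rpow hD hpos.le]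
  gcongr
  exact h t k

end Finiteness

/-! ### Assembly of the inequality. -/

section Main

lemma cdfVec_eq {Ω ι : Type*} [MeasurableSpace Ω] [Finite ι] (P : Measure Ω) {X : Ω → ι → ℝ}
    (hX : Measurable X) : cdfVec P X = fun z => (P.map X).real (Set.Iic z) := by
  ext z
  rw [cdfVec, map_measureReal_apply hX measurableSet_Iic]
  rfl

/-- Multivariate Berry–Esseen smoothing inequality for measures. -/
theorem exists_abs_cdf_sub_le (ι : Type*) [Fintype ι] [DecidableEq ι] [Nonempty ι] :
    ∃ C : ℝ≥0, ∀ (μ ν : Measure (ι → ℝ)) [IsProbabilityMeasure μ] [IsProbabilityMeasure ν],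
      Differentiable ℝ (fun z => ν.real (Set.Iic z)) → ∀ T : ℝ, 0 < T → ∀ z : ι → ℝ,
        ENNReal.ofReal |μ.real (Set.Iic z) - ν.real (Set.Iic z)| ≤
          C * ((∑ K : Finset ι with K.Nonempty,
            lambdaIntegral (piCharFun μ) (piCharFun ν) K T) +
              (∑ j, supPartial (fun z => ν.real (Set.Iic z)) j) / ENNReal.ofReal T) := by
  obtain ⟨C, hC, hCdf⟩ := exists_smoothCdf_le ι
  obtain ⟨r, hr, hρ⟩ := exists_fejerPi_closedBall ι
  -- `3 * r` and `2 * C` come from `abs_cdf_sub_le`. The `1` keeps the constant positive, so that an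
  -- infinite right-hand side is not annihilated by `0 * ∞ = 0`.
  refine ⟨(1 + 3 * r + 2 * C).toNNReal, fun μ ν _ _ hν T hT z => ?_⟩
  have hC0 : 0 < 1 + 3 * r + 2 * C := by positivity
  set I := ∑ K : Finset ι with K.Nonempty, lambdaIntegral (piCharFun μ) (piCharFun ν) K T with hI
  set S := ∑ j, supPartial (fun z => ν.real (Set.Iic z)) j with hS
  change _ ≤ ENNReal.ofReal (1 + 3 * r + 2 * C) * _
  have hCne : ENNReal.ofReal (1 + 3 * r + 2 * C) ≠ 0 := (ENNReal.ofReal_pos.2 hC0).ne'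
  by_cases hItop : I = ∞
  · rw [hItop, top_add, ENNReal.mul_top hCne]
    exact le_top
  by_cases hStop : S = ∞
  · rw [hStop, ENNReal.top_div_of_ne_top ENNReal.ofReal_ne_top, add_top, ENNReal.mul_top hCne]
    exact le_top
  have hSj : ∀ j, supPartial (fun z => ν.real (Set.Iic z)) j ≠ ∞ := fun j =>
    (ENNReal.sum_ne_top.1 hStop) j (Finset.mem_univ j)
  have hder : ∀ y j, fderiv ℝ (fun z => ν.real (Set.Iic z)) y (Pi.single j 1) ≤
      (supPartial (fun z => ν.real (Set.Iic z)) j).toReal := by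
    intro y j
    rw [← ENNReal.ofReal_le_iff_le_toReal (hSj j)]
    exact le_iSup (fun y : ι → ℝ =>
      ENNReal.ofReal (fderiv ℝ (fun z => ν.real (Set.Iic z)) y (Pi.single j 1))) y
  have hSreal : S.toReal = ∑ j, (supPartial (fun z => ν.real (Set.Iic z)) j).toReal :=
    ENNReal.toReal_sum fun j _ => hSj j
  have hmain := abs_cdf_sub_le (B := C * I.toReal) (A := S.toReal) hT hρ μ ν (fun b => by
      have := hCdf μ ν T hT b
      rw [← hI, ← ENNReal.ofReal_toReal hItop, ← ENNReal.ofReal_mul hC] at this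
      exact (ENNReal.ofReal_le_ofReal_iff (by positivity)).1 this)
    (fun x v hv hvr => by
      refine (le_add_sum_of_fderiv_le hν hder x v hv).trans ?_
      rw [hSreal, Finset.mul_sum]
      refine add_le_add le_rfl (Finset.sum_le_sum fun j _ => ?_)
      rw [mul_comm]
      exact mul_le_mul_of_nonneg_right (hvr j) ENNReal.toReal_nonneg) z
  have hdiv : S / ENNReal.ofReal T = ENNReal.ofReal (S.toReal / T) := by
    rw [ENNReal.ofReal_div_of_pos hT, ENNReal.ofReal_toReal hStop]
  rw [hdiv, ← ENNReal.ofReal_toReal hItop, ← ENNReal.ofReal_add (by positivity) (by positivity),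
    ← ENNReal.ofReal_mul hC0.le]
  refine ENNReal.ofReal_le_ofReal (hmain.trans ?_)
  have h1 : 0 ≤ S.toReal / T := by positivity
  have h2 : 0 ≤ I.toReal := ENNReal.toReal_nonneg
  have h3 : r / T * S.toReal = r * (S.toReal / T) := by ring
  nlinarith [mul_nonneg hr h2, mul_nonneg hC h1]

end Main

end BerryEsseen


theorem corollary3 (m : ℕ) (hm : 1 ≤ m) :
    ∃ C : ℝ≥0, ∀ {Ω Ω' : Type*} [MeasurableSpace Ω] [MeasurableSpace Ω']
      (P : Measure Ω) (P' : Measure Ω') [IsProbabilityMeasure P] [IsProbabilityMeasure P']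
      (X : Ω → Fin m → ℝ) (Y : Ω' → Fin m → ℝ), Measurable X → Measurable Y →
      Differentiable ℝ (BerryEsseen.cdfVec P' Y) →
      ∀ T : ℝ, 0 < T →
        (⨆ z : Fin m → ℝ,
            ENNReal.ofReal |BerryEsseen.cdfVec P X z - BerryEsseen.cdfVec P' Y z|) ≤
          C * ((∑ K : Finset (Fin m) with K.Nonempty,
                  BerryEsseen.lambdaIntegral
                    (BerryEsseen.charFunVec P X) (BerryEsseen.charFunVec P' Y) K T) +
                (∑ j : Fin m, BerryEsseen.supPartial (BerryEsseen.cdfVec P' Y) j) /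
                  ENNReal.ofReal T) ∧
        (Integrable X P → Integrable Y P' →
          ∀ K : Finset (Fin m), K.Nonempty →
            BerryEsseen.lambdaIntegral
              (BerryEsseen.charFunVec P X) (BerryEsseen.charFunVec P' Y) K T < ∞) := by
  have hne : Nonempty (Fin m) := ⟨⟨0, hm⟩⟩
  obtain ⟨C, hC⟩ := BerryEsseen.exists_abs_cdf_sub_le (Fin m)
  refine ⟨C, ?_⟩
  intro Ω Ω' _ _ P P' _ _ X Y hX hY hdiff T hT
  have hPX : IsProbabilityMeasure (P.map X) := Measure.isProbabilityMeasure_map hX.aemeasurable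
  have hPY : IsProbabilityMeasure (P'.map Y) := Measure.isProbabilityMeasure_map hY.aemeasurable
  rw [BerryEsseen.cdfVec_eq P' hY] at hdiff ⊢
  rw [BerryEsseen.cdfVec_eq P hX, BerryEsseen.charFunVec_eq_piCharFun P hX,
    BerryEsseen.charFunVec_eq_piCharFun P' hY]
  refine ⟨iSup_le fun z => hC _ _ hdiff T hT z, fun hXi hYi K hK => ?_⟩
  refine BerryEsseen.lambdaIntegral_lt_top _ _ ?_ ?_ hK T
  · exact (integrable_map_measure (by fun_prop) hX.aemeasurable).2 hXi
  · exact (integrable_map_measure (by fun_prop) hY.aemeasurable).2 hYi
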